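/- Let $D$ be a random variable with values in $\mathbb{Z}_+$ and mean $0<\mathbb{E}D<\infty$; its law does not depend on $N$. For each $N$, consider the random bipartite graph with $N$ senders and $N$ receivers in which the degrees $D_u$ of the senders $u$ are i.i.d. copies of $\min\{D,N\}$ and, given its degree, each sender chooses its set of neighbours uniformly at random among the sets of $D_u$ receivers, independently of the other senders. Under greedy minimum-degree selection $\mathrm{DB}(-\infty)$, given the graph, each sender of non-zero degree independently sends one grant, to a receiver chosen uniformly at random among its neighbours of smallest degree; each receiver that has received at least one grant accepts exactly one of them, chosen uniformly at random. Let $L_N(-\infty)$ be the size of the resulting matching. Let $G_D(z)=\mathbb{E}[z^D]$, let $\pi_k=e^{-\mathbb{E}D}(\mathbb{E}D)^k/k!$ for $k\ge 0$ and $\Pi_k=\sum_{0\le j\le k}\pi_j$ be the probability mass function and the distribution function of the Poisson law with parameter $\mathbb{E}D$ (so $\Pi_{-1}=0$), and let $\bar\Pi_k=1-\Pi_k$. Put $f(0)=0$ and, for $s\ge 1$, $$f(s)=\frac{G_D(\bar\Pi_{s-2})-G_D(\bar\Pi_{s-1})}{\mathbb{E}D\;\pi_{s-1}}.$$ **Theorem.**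 One has $f(s)\in[0,1]$ for all $s\ge 0$, the series below converges, and $$\liminf_{N\to\infty}\frac1N\,\mathbb{E}L_N(-\infty)\;\ge\;1-\sum_{s=0}^{\infty}e^{-\mathbb{E}D}\frac{(\mathbb{E}D)^s}{s!}\,(1-f(s))^s .$$ -/

import Mathlib

namespace DegreeBiased

/-! ### Probability on finite types -/

/-- The law of a family of independent random variables `(X i)`, `X i` having law `p i`. -/
noncomputable def indepLaw {ι β : Type*} [Fintype ι] [DecidableEq ι] [Fintype β]
    (p : ι → PMF β) : PMF (ι → β) :=
  PMF.ofFintype (fun x => ∏ i, p i (x i)) (by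
    rw [← Fintype.piFinset_univ, ← Finset.prod_univ_sum]
    refine Finset.prod_eq_one fun i _ => ?_
    rw [← tsum_fintype (L := .unconditional _)]
    exact (p i).tsum_coe)

/-- The expectation of `X` under a law `p` on a finite type. -/
noncomputable def expect {β : Type*} [Fintype β] (p : PMF β) (X : β → ℝ) : ℝ :=
  ∑ x, (p x).toReal * X x

/-- The uniform choice of an element of a finite set; no choice is made if the set is empty. -/
noncomputable def uniformChoice {β : Type*} (s : Finset β) : PMF (Option β) :=
  open Classical in
  if h : s.Nonempty then (PMF.uniformOfFinset s h).map some else PMF.pure none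

/-! ### The random graph

The senders and the receivers are both indexed by `Fin N`. A bipartite graph is recorded by
the neighbourhoods of its senders. -/

/-- A bipartite graph between `N` senders and `N` receivers: `G u` is the set of receivers
adjacent to the sender `u`. -/
abbrev BipGraph (N : ℕ) := Fin N → Finset (Fin N)

/-- The degree of the receiver `v`. -/
def receiverDegree {N : ℕ} (G : BipGraph N) (v : Fin N) : ℕ :=
  (Finset.univ.filter fun u => v ∈ G u).card

/-- The law of the neighbourhood of one sender: its degree is a copy of `min D N`, and given
its degree, the neighbourhood is a uniformly random set of receivers of this size. -/
noncomputable def neighbourhoodLaw (D : PMF ℕ) (N : ℕ) : PMF (Finset (Fin N)) :=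
  D.bind fun k =>
    PMF.uniformOfFinset (Finset.powersetCard (min k N) (Finset.univ : Finset (Fin N)))
      (Finset.powersetCard_nonempty.2 (by simp))

/-- The law of the `D`-out random bipartite graph: the neighbourhoods of the senders are
independent. -/
noncomputable def outGraphLaw (D : PMF ℕ) (N : ℕ) : PMF (BipGraph N) :=
  indepLaw fun _ => neighbourhoodLaw D N

/-! ### The matching algorithm with greedy minimum-degree selection -/

/-- The neighbours of the sender `u` that have the smallest degree among its neighbours. -/
def minDegreeNeighbours {N : ℕ} (G : BipGraph N) (u : Fin N) : Finset (Fin N) :=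
  (G u).filter fun v => ∀ w ∈ G u, receiverDegree G v ≤ receiverDegree G w

/-- The law of the grants, given the graph: independently of each other, the senders of
non-zero degree choose a receiver uniformly among their neighbours of smallest degree. -/
noncomputable def grantLaw {N : ℕ} (G : BipGraph N) : PMF (Fin N → Option (Fin N)) :=
  indepLaw fun u => uniformChoice (minDegreeNeighbours G u)

/-- The law of the accepts, given the grants `g`: independently of each other, the receivers
that have received a grant choose a sender uniformly among those who sent them a grant. -/
noncomputable def acceptLaw {N : ℕ} (g : Fin N → Option (Fin N)) :
    PMF (Fin N → Option (Fin N)) :=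
  indepLaw fun v => uniformChoice (Finset.univ.filter fun u => g u = some v)

/-- The matching determined by the accepts `a`: the pairs `(u, v)` such that the receiver `v`
accepts the sender `u`. -/
def matchingOf {N : ℕ} (a : Fin N → Option (Fin N)) : Finset (Fin N × Fin N) :=
  Finset.univ.filter fun e => a e.2 = some e.1

/-- The law of the matching produced on the `D`-out random bipartite graph. -/
noncomputable def matchingLaw (D : PMF ℕ) (N : ℕ) : PMF (Finset (Fin N × Fin N)) :=
  (outGraphLaw D N).bind fun G => (grantLaw G).bind fun g => (acceptLaw g).map matchingOf

/-- The mean size of the matching. -/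
noncomputable def meanMatchingSize (D : PMF ℕ) (N : ℕ) : ℝ :=
  expect (matchingLaw D N) fun M => (M.card : ℝ)

/-! ### The quantities in the bound -/

/-- The mean of a law on `ℕ`. -/
noncomputable def mean (D : PMF ℕ) : ℝ := ∑' k : ℕ, (D k).toReal * k

/-- The generating function of a law on `ℕ`. -/
noncomputable def genFun (D : PMF ℕ) (z : ℝ) : ℝ := ∑' k : ℕ, (D k).toReal * z ^ k

/-- The probability mass function of the Poisson law with parameter `m`. -/
noncomputable def poissonMass (m : ℝ) (k : ℕ) : ℝ := Real.exp (-m) * m ^ k / (k.factorial : ℝ)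

/-- The distribution function of the Poisson law with parameter `m`, at an integer `k`;
it is `0` for negative `k`. -/
noncomputable def poissonCdf (m : ℝ) (k : ℤ) : ℝ :=
  ∑ j ∈ Finset.range (k + 1).toNat, poissonMass m j

/-- The complementary distribution function of the Poisson law with parameter `m`. -/
noncomputable def poissonTail (m : ℝ) (k : ℤ) : ℝ := 1 - poissonCdf m k

/-- The limiting probability that a neighbour of a receiver of degree `s` selects it. -/
noncomputable def selectionProb (D : PMF ℕ) (s : ℕ) : ℝ :=
  if s = 0 then 0
  else (genFun D (poissonTail (mean D) ((s : ℤ) - 2)) -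
      genFun D (poissonTail (mean D) ((s : ℤ) - 1))) /
    (mean D * poissonMass (mean D) (s - 1))

end DegreeBiased

/-! A receiver holding a grant accepts exactly one, so the mean matching size is the sum over
receivers `v` of the probability that `v` is granted (`meanMatchingSize_eq`). Around `v` the graph
resembles a branching tree. With `m` the mean of `D`, the receiver `v` has Poisson(`m`) many
neighbours; each of them has `e` other neighbours with probability `(e + 1) P(D = e + 1) / m`; each
of those competitors has Poisson(`m`) many further senders. If `v` has degree `k + 1`, a neighbour
can select it only when all its competitors have at least `k` further senders, and ties are broken
uniformly. Since `1 / (1 + j)` is the integral of `t ^ j` over `[0, 1]`, the selection probability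
given `e` is the integral of `(b + q t) ^ e`, where `q` and `b` are the Poisson masses of `k` and of
the integers above `k` (`sum_prod_mul_tieProb`). In the average over `e` the factor `e + 1` cancels,
which leaves `f (k + 1)` (`hasSum_sizeBiasedMass_mul_limitTieMean`). The neighbours act
independently in the tree, so `v` is granted with probability `1 - (1 - f (k + 1)) ^ (k + 1)`.

Only a lower bound is wanted, so it is enough to add up the contributions of disjoint events,
without showing that they exhaust the graph. Such an event (`Cylinder`) prescribes the set `S` of
neighbours of `v`, a partial function `a` assigning other receivers to senders in `S`, and a partial
function `c` telling which single explored receiver a sender outside `S` meets, if any. Being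
functions, `a` and `c` force the tree shape. On a cylinder all relevant degrees are known
(`Cylinder.grantedProb_eq`), and its probability is a product (`expect_cylinder`). Counting the `a`
and `c` with given fibre sizes turns the sum into a branching expectation, with the errors recorded
in `LocalApprox`. The sizes are truncated at `n` and `K`; the limits are taken in `N`, then `K`,
then `n`. -/

namespace DegreeBiased

/-! ### Expectations on finite types -/

theorem expect_bind {β γ : Type*} [Fintype β] [Fintype γ] (p : PMF β) (f : β → PMF γ)
    (X : γ → ℝ) : expect (p.bind f) X = expect p fun x => expect (f x) X := by
  unfold expect
  simp_rw [PMF.bind_apply, tsum_fintype, Finset.mul_sum]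
  rw [Finset.sum_comm]
  refine Finset.sum_congr rfl fun y _ => ?_
  rw [ENNReal.toReal_sum fun x _ => ENNReal.mul_ne_top (p.apply_ne_top x) ((f x).apply_ne_top y),
    Finset.sum_mul]
  exact Finset.sum_congr rfl fun x _ => by rw [ENNReal.toReal_mul, mul_assoc]

theorem expect_pure {β : Type*} [Fintype β] (x : β) (X : β → ℝ) :
    expect (PMF.pure x) X = X x := by
  classical
  unfold expect
  rw [Finset.sum_eq_single x] <;> simp +contextual [PMF.pure_apply]

theorem expect_map {β γ : Type*} [Fintype β] [Fintype γ] (p : PMF β) (f : β → γ)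
    (X : γ → ℝ) : expect (p.map f) X = expect p fun x => X (f x) := by
  rw [← PMF.bind_pure_comp, expect_bind]
  simp [expect_pure]

theorem expect_one {β : Type*} [Fintype β] (p : PMF β) : expect p (fun _ => 1) = 1 := by
  unfold expect
  simp_rw [mul_one]
  rw [← ENNReal.toReal_sum fun x _ => p.apply_ne_top x, ← tsum_fintype (L := .unconditional _),
    p.tsum_coe, ENNReal.toReal_one]

theorem expect_sub {β : Type*} [Fintype β] (p : PMF β) (X Y : β → ℝ) :
    expect p (fun x => X x - Y x) = expect p X - expect p Y := by
  simp [expect, mul_sub]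

theorem expect_sum {β ι : Type*} [Fintype β] (p : PMF β) (s : Finset ι) (X : ι → β → ℝ) :
    expect p (fun x => ∑ i ∈ s, X i x) = ∑ i ∈ s, expect p (X i) := by
  unfold expect
  simp_rw [Finset.mul_sum]
  exact Finset.sum_comm

theorem expect_mono {β : Type*} [Fintype β] (p : PMF β) {X Y : β → ℝ} (h : ∀ x, X x ≤ Y x) :
    expect p X ≤ expect p Y :=
  Finset.sum_le_sum fun x _ => mul_le_mul_of_nonneg_left (h x) ENNReal.toReal_nonneg

theorem expect_mul_const {β : Type*} [Fintype β] (p : PMF β) (X : β → ℝ) (c : ℝ) :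
    expect p (fun x => X x * c) = expect p X * c := by
  simp [expect, Finset.sum_mul, mul_assoc]

/-- Expanding a product of sums. Every use of independence below passes through this identity. -/
theorem expect_indepLaw_prod {ι β : Type*} [Fintype ι] [DecidableEq ι] [Fintype β]
    (p : ι → PMF β) (X : ι → β → ℝ) :
    expect (indepLaw p) (fun x => ∏ i, X i (x i)) = ∏ i, expect (p i) (X i) := by
  unfold expect
  rw [Finset.prod_univ_sum, Fintype.piFinset_univ]
  refine Finset.sum_congr rfl fun x _ => ?_
  rw [indepLaw, PMF.ofFintype_apply, ENNReal.toReal_prod, Finset.prod_mul_distrib]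

theorem expect_indepLaw_apply {ι β : Type*} [Fintype ι] [DecidableEq ι] [Fintype β]
    (p : ι → PMF β) (i : ι) (X : β → ℝ) :
    expect (indepLaw p) (fun x => X (x i)) = expect (p i) X := by
  have h := expect_indepLaw_prod p fun j y => if j = i then X y else 1
  rw [Finset.prod_eq_single i (fun j _ hj => by simp [hj, expect_one]) (by simp)] at h
  simpa using h

/-! ### Grants and accepts, given the graph -/

theorem expect_uniformChoice_eq_some {β : Type*} [Fintype β] [DecidableEq β] (s : Finset β)
    (v : β) : expect (uniformChoice s) (fun o => if o = some v then 1 else 0) =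
      if v ∈ s then (s.card : ℝ)⁻¹ else 0 := by
  unfold uniformChoice
  by_cases h : s.Nonempty
  · rw [dif_pos h, expect_map]
    simp [expect, PMF.uniformOfFinset_apply]
    split_ifs <;> simp
  · rw [dif_neg h, expect_pure]
    rw [Finset.not_nonempty_iff_eq_empty] at h
    simp [h]

theorem expect_uniformChoice_isSome {β : Type*} [Fintype β] (s : Finset β) [Decidable s.Nonempty] :
    expect (uniformChoice s) (fun o => if o.isSome then 1 else 0) =
      if s.Nonempty then 1 else 0 := by
  unfold uniformChoice
  by_cases h : s.Nonempty
  · rw [dif_pos h, expect_map, if_pos h]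
    simp [expect_one]
  · rw [dif_neg h, expect_pure]
    simp [h]

/-- The probability that the sender `u` selects the receiver `v`. -/
noncomputable def grantProb {N : ℕ} (G : BipGraph N) (v u : Fin N) : ℝ :=
  if v ∈ minDegreeNeighbours G u then ((minDegreeNeighbours G u).card : ℝ)⁻¹ else 0

theorem grantProb_nonneg {N : ℕ} (G : BipGraph N) (v u : Fin N) : 0 ≤ grantProb G v u := by
  unfold grantProb; positivity

theorem grantProb_le_one {N : ℕ} (G : BipGraph N) (v u : Fin N) : grantProb G v u ≤ 1 := by
  unfold grantProb
  split_ifs with h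
  · exact inv_le_one_of_one_le₀ (by exact_mod_cast Finset.card_pos.2 ⟨v, h⟩)
  · exact zero_le_one

/-- The probability that the receiver `v` receives a grant, given the graph. -/
noncomputable def grantedProb {N : ℕ} (G : BipGraph N) (v : Fin N) : ℝ :=
  1 - ∏ u, (1 - grantProb G v u)

theorem grantedProb_nonneg {N : ℕ} (G : BipGraph N) (v : Fin N) : 0 ≤ grantedProb G v :=
  sub_nonneg.2 (Finset.prod_le_one (fun u _ => sub_nonneg.2 (grantProb_le_one G v u))
    fun u _ => sub_le_self _ (grantProb_nonneg G v u))

theorem grantedProb_le_one {N : ℕ} (G : BipGraph N) (v : Fin N) : grantedProb G v ≤ 1 :=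
  sub_le_self _ (Finset.prod_nonneg fun u _ => sub_nonneg.2 (grantProb_le_one G v u))

theorem card_matchingOf {N : ℕ} (a : Fin N → Option (Fin N)) :
    ((matchingOf a).card : ℝ) = ∑ v, if (a v).isSome then 1 else 0 := by
  rw [matchingOf, Finset.card_filter, Fintype.sum_prod_type_right]
  push_cast
  refine Finset.sum_congr rfl fun v _ => ?_
  cases h : a v <;> simp

/-- A receiver is matched as soon as it has a grant, however it accepts. The indicator is written as
one minus a product over senders so that its mean over independent grants factorises. -/
theorem expect_acceptLaw_card {N : ℕ} (g : Fin N → Option (Fin N)) :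
    expect (acceptLaw g) (fun a => ((matchingOf a).card : ℝ)) =
      ∑ v, (1 - ∏ u, (1 - if g u = some v then (1 : ℝ) else 0)) := by
  simp_rw [card_matchingOf]
  rw [expect_sum]
  refine Finset.sum_congr rfl fun v _ => ?_
  classical
  rw [acceptLaw, expect_indepLaw_apply _ v (fun o : Option (Fin N) => if o.isSome then (1 : ℝ) else 0),
    expect_uniformChoice_isSome]
  split_ifs with h
  · obtain ⟨u, hu⟩ := h
    rw [Finset.prod_eq_zero (Finset.mem_univ u), sub_zero]
    simp [(Finset.mem_filter.1 hu).2]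
  · rw [Finset.prod_eq_one, sub_self]
    intro u _
    rw [if_neg, sub_zero]
    exact fun hu => h ⟨u, by simp [hu]⟩

theorem expect_grantLaw_card {N : ℕ} (G : BipGraph N) :
    expect (grantLaw G) (fun g => expect (acceptLaw g) fun a => ((matchingOf a).card : ℝ)) =
      ∑ v, grantedProb G v := by
  simp_rw [expect_acceptLaw_card]
  rw [expect_sum]
  refine Finset.sum_congr rfl fun v _ => ?_
  rw [expect_sub, expect_one, grantLaw,
    expect_indepLaw_prod (X := fun u o => 1 - if o = some v then (1 : ℝ) else 0), grantedProb]
  congr 1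
  refine Finset.prod_congr rfl fun u _ => ?_
  rw [expect_sub, expect_one, expect_uniformChoice_eq_some, grantProb]

theorem meanMatchingSize_eq (D : PMF ℕ) (N : ℕ) :
    meanMatchingSize D N = ∑ v, expect (outGraphLaw D N) fun G => grantedProb G v := by
  rw [meanMatchingSize, matchingLaw, expect_bind]
  simp_rw [expect_bind, expect_map, expect_grantLaw_card]
  rw [expect_sum]

theorem meanMatchingSize_le (D : PMF ℕ) (N : ℕ) : meanMatchingSize D N ≤ N := by
  rw [meanMatchingSize_eq]
  calc _ ≤ ∑ _v : Fin N, (1 : ℝ) := Finset.sum_le_sum fun v _ => by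
        rw [← expect_one (outGraphLaw D N)]
        exact expect_mono _ fun G => grantedProb_le_one G v
    _ = N := by simp

/-! ### The neighbourhood of one sender -/

/-- The mass that the law of one neighbourhood gives to a set of receivers. -/
noncomputable def neighbourhoodMass (D : PMF ℕ) (N : ℕ) (A : Finset (Fin N)) : ℝ :=
  (neighbourhoodLaw D N A).toReal

theorem neighbourhoodMass_nonneg (D : PMF ℕ) (N : ℕ) (A : Finset (Fin N)) :
    0 ≤ neighbourhoodMass D N A := ENNReal.toReal_nonneg

theorem sum_neighbourhoodMass (D : PMF ℕ) (N : ℕ) : ∑ A, neighbourhoodMass D N A = 1 := by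
  simpa [neighbourhoodMass, expect] using expect_one (neighbourhoodLaw D N)

theorem neighbourhoodMass_eq_tsum (D : PMF ℕ) (N : ℕ) (A : Finset (Fin N)) :
    neighbourhoodMass D N A =
      ∑' k, (D k).toReal * if A.card = min k N then ((N.choose (min k N) : ℝ))⁻¹ else 0 := by
  rw [neighbourhoodMass, neighbourhoodLaw, PMF.bind_apply, ENNReal.tsum_toReal_eq]
  · refine tsum_congr fun k => ?_
    rw [ENNReal.toReal_mul, PMF.uniformOfFinset_apply]
    simp only [Finset.mem_powersetCard, Finset.subset_univ, true_and, Finset.card_powersetCard,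
      Finset.card_univ, Fintype.card_fin]
    split_ifs <;> simp
  · exact fun k => ENNReal.mul_ne_top (D.apply_ne_top k) (PMF.apply_ne_top _ _)

theorem summable_toReal (D : PMF ℕ) : Summable fun k => (D k).toReal :=
  ENNReal.summable_toReal D.tsum_coe_ne_top

theorem summable_toReal_mul {D : PMF ℕ} {g : ℕ → ℝ} (h0 : ∀ k, 0 ≤ g k) (h1 : ∀ k, g k ≤ 1) :
    Summable fun k => (D k).toReal * g k :=
  (summable_toReal D).of_nonneg_of_le (fun k => mul_nonneg ENNReal.toReal_nonneg (h0 k))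
    fun k => mul_le_of_le_one_right ENNReal.toReal_nonneg (h1 k)

theorem inv_choose_le_one (N k : ℕ) : ((N.choose k : ℝ))⁻¹ ≤ 1 := by
  rcases Nat.eq_zero_or_pos (N.choose k) with h | h
  · simp [h]
  · exact inv_le_one_of_one_le₀ (by exact_mod_cast h)

/-- Only the degree `k = A.card` is kept. This loses mass at most when `A` is the full set, which
collects all degrees `k ≥ N`. -/
theorem le_neighbourhoodMass (D : PMF ℕ) {N : ℕ} (A : Finset (Fin N)) :
    (D A.card).toReal * (N.choose A.card : ℝ)⁻¹ ≤ neighbourhoodMass D N A := by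
  have hA : min A.card N = A.card := min_eq_left (by simpa using A.card_le_univ)
  rw [neighbourhoodMass_eq_tsum]
  have hs : Summable fun k => (D k).toReal *
      if A.card = min k N then ((N.choose (min k N) : ℝ))⁻¹ else 0 :=
    summable_toReal_mul (fun k => by positivity) fun k => by
      split_ifs
      · exact inv_choose_le_one _ _
      · exact zero_le_one
  have h := hs.le_tsum A.card fun k _ => mul_nonneg ENNReal.toReal_nonneg (by positivity)
  rwa [hA, if_pos rfl] at h

/-- A uniform set of `j + 1` receivers out of `M + 1` contains `w` with probability `(j + 1) / (M +
1)`; here `j + 1 = min k N ≤ k`. -/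
theorem sum_neighbourhoodMass_mem_le {D : PMF ℕ}
    (hD : Summable fun k : ℕ => (D k).toReal * (k : ℝ)) {N : ℕ} (w : Fin N) :
    ∑ A with w ∈ A, neighbourhoodMass D N A ≤ mean D / N := by
  have hN : 0 < N := w.pos
  simp_rw [neighbourhoodMass_eq_tsum]
  rw [← Summable.tsum_finsetSum]
  · rw [mean, ← tsum_div_const]
    refine Summable.tsum_le_tsum (fun k => ?_) ?_ (hD.div_const _)
    · rw [← Finset.mul_sum, mul_div_assoc]
      refine mul_le_mul_of_nonneg_left ?_ ENNReal.toReal_nonneg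
      rw [← Finset.sum_filter, Finset.sum_const, Finset.filter_filter, nsmul_eq_mul,
        ← div_eq_mul_inv]
      rcases Nat.eq_zero_or_pos k with rfl | hk
      · rw [Finset.card_eq_zero.2]
        · simp
        · ext A; simp; rintro h rfl; simp at h
      obtain ⟨j, hj⟩ : ∃ j, min k N = j + 1 := ⟨min k N - 1, by omega⟩
      obtain ⟨M, rfl⟩ : ∃ M, N = M + 1 := ⟨N - 1, by omega⟩
      have hcard : (Finset.univ.filter fun A : Finset (Fin (M + 1)) =>
          w ∈ A ∧ A.card = j + 1).card ≤ M.choose j := by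
        have : M.choose j = (Finset.powersetCard j (Finset.univ.erase w)).card := by
          simp [Finset.card_powersetCard]
        rw [this]
        refine Finset.card_le_card_of_injOn (fun A => A.erase w) ?_ ?_
        · intro A hA
          simp only [Finset.coe_filter, Finset.mem_univ, true_and, Set.mem_ofPred_eq] at hA
          simp only [Finset.mem_coe, Finset.mem_powersetCard]
          refine ⟨Finset.erase_subset_erase _ (Finset.subset_univ _), ?_⟩
          rw [Finset.card_erase_of_mem hA.1, hA.2]; rfl
        · intro A hA B hB h
          simp only [Finset.coe_filter, Finset.mem_univ, true_and, Set.mem_ofPred_eq] at hA hB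
          rw [← Finset.insert_erase hA.1, ← Finset.insert_erase hB.1]
          simp only at h
          rw [h]
      rw [hj]
      have hpos : (0 : ℝ) < (M + 1).choose (j + 1) := by
        exact_mod_cast Nat.choose_pos (by omega)
      rw [div_le_div_iff₀ hpos (by positivity)]
      have h1 : (M + 1) * M.choose j = (M + 1).choose (j + 1) * (j + 1) :=
        Nat.add_one_mul_choose_eq M j
      have h2 : (Finset.univ.filter fun A : Finset (Fin (M + 1)) =>
          w ∈ A ∧ A.card = j + 1).card * (M + 1) ≤ k * (M + 1).choose (j + 1) := by
        calc _ ≤ M.choose j * (M + 1) := Nat.mul_le_mul_right _ hcard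
          _ = (j + 1) * (M + 1).choose (j + 1) := by rw [mul_comm, h1, mul_comm]
          _ ≤ _ := Nat.mul_le_mul_right _ (by omega)
      exact_mod_cast h2
    · refine summable_sum fun A _ => summable_toReal_mul (fun k => by positivity) fun k => ?_
      split_ifs
      · exact inv_choose_le_one _ _
      · exact zero_le_one
  · refine fun A _ => summable_toReal_mul (fun k => by positivity) fun k => ?_
    split_ifs
    · exact inv_choose_le_one _ _
    · exact zero_le_one

/-- The probability that a neighbourhood meets the set `W` exactly in `T`. -/
noncomputable def traceMass (D : PMF ℕ) {N : ℕ} (W T : Finset (Fin N)) : ℝ :=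
  ∑ A with A ∩ W = T, neighbourhoodMass D N A

theorem traceMass_nonneg (D : PMF ℕ) {N : ℕ} (W T : Finset (Fin N)) : 0 ≤ traceMass D W T :=
  Finset.sum_nonneg fun A _ => neighbourhoodMass_nonneg D N A

theorem traceMass_le_one (D : PMF ℕ) {N : ℕ} (W T : Finset (Fin N)) : traceMass D W T ≤ 1 := by
  rw [← sum_neighbourhoodMass D N]
  exact Finset.sum_le_sum_of_subset_of_nonneg (Finset.filter_subset _ _)
    fun A _ _ => neighbourhoodMass_nonneg D N A

/-- Union bound over the elements of `W`. -/
theorem le_traceMass_empty {D : PMF ℕ}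
    (hD : Summable fun k : ℕ => (D k).toReal * (k : ℝ)) {N : ℕ} (W : Finset (Fin N)) :
    1 - W.card * (mean D / N) ≤ traceMass D W ∅ := by
  have h : ∑ A, neighbourhoodMass D N A ≤ traceMass D W ∅ +
      ∑ w ∈ W, ∑ A with w ∈ A, neighbourhoodMass D N A := by
    simp_rw [traceMass, Finset.sum_filter]
    rw [Finset.sum_comm, ← Finset.sum_add_distrib]
    refine Finset.sum_le_sum fun A _ => ?_
    have h0 := neighbourhoodMass_nonneg D N A
    have hs : ∀ w ∈ W, 0 ≤ if w ∈ A then neighbourhoodMass D N A else 0 :=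
      fun w _ => by positivity
    by_cases hA : A ∩ W = ∅
    · rw [if_pos hA]
      exact le_add_of_nonneg_right (Finset.sum_nonneg hs)
    · rw [if_neg hA, zero_add]
      obtain ⟨w, hw⟩ := Finset.nonempty_iff_ne_empty.2 hA
      rw [Finset.mem_inter] at hw
      exact (if_pos hw.1).symm.trans_le (Finset.single_le_sum hs hw.2)
  rw [sum_neighbourhoodMass] at h
  have h2 : ∑ w ∈ W, ∑ A with w ∈ A, neighbourhoodMass D N A ≤ W.card * (mean D / N) := by
    rw [← nsmul_eq_mul]
    exact Finset.sum_le_card_nsmul _ _ _ fun w _ => sum_neighbourhoodMass_mem_le hD w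
  linarith

/-- Counts the neighbourhoods `insert w B` with `B` of size `d < K` outside `W`. The cutoff `K`
makes the estimate a finite sum, to be compared with its limit term by term. -/
theorem le_traceMass_singleton (D : PMF ℕ) {N : ℕ} {W : Finset (Fin N)} {w : Fin N} (hw : w ∈ W)
    (K : ℕ) :
    ∑ d ∈ Finset.range K, (D (d + 1)).toReal *
      ((N - W.card).choose d * (N.choose (d + 1) : ℝ)⁻¹) ≤ traceMass D W {w} := by
  have hsub : ((Finset.range K).sigma fun d => Finset.powersetCard d Wᶜ).image
      (fun x => insert w x.2) ⊆ Finset.univ.filter fun A => A ∩ W = {w} := by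
    intro A hA
    simp only [Finset.mem_image, Finset.mem_sigma, Finset.mem_powersetCard] at hA
    obtain ⟨⟨d, B⟩, ⟨_, hB, _⟩, rfl⟩ := hA
    simp only [Finset.mem_filter, Finset.mem_univ, true_and]
    rw [Finset.insert_inter_of_mem hw, Finset.disjoint_iff_inter_eq_empty.1
      (Finset.disjoint_left.2 fun x hx => Finset.mem_compl.1 (hB hx))]
    rfl
  refine le_trans ?_ (Finset.sum_le_sum_of_subset_of_nonneg hsub
    fun A _ _ => neighbourhoodMass_nonneg D N A)
  have hnot : ∀ {d} {B : Finset (Fin N)}, B ∈ Finset.powersetCard d Wᶜ → w ∉ B :=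
    fun hB h => Finset.mem_compl.1 ((Finset.mem_powersetCard.1 hB).1 h) hw
  rw [Finset.sum_image, Finset.sum_sigma]
  · refine Finset.sum_le_sum fun d _ => ?_
    calc _ = ∑ _B ∈ Finset.powersetCard d Wᶜ, (D (d + 1)).toReal * (N.choose (d + 1) : ℝ)⁻¹ := by
          rw [Finset.sum_const, Finset.card_powersetCard, Finset.card_compl, Fintype.card_fin,
            nsmul_eq_mul]
          ring
      _ ≤ _ := Finset.sum_le_sum fun B hB => by
          have hc : (insert w B).card = d + 1 := by
            rw [Finset.card_insert_of_notMem (hnot hB), (Finset.mem_powersetCard.1 hB).2]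
          rw [← hc]
          exact le_neighbourhoodMass D _
  · rintro ⟨d, B⟩ hB ⟨d', B'⟩ hB' h
    simp only [Finset.coe_sigma, Set.mem_sigma_iff, Finset.mem_coe] at hB hB'
    have h' : B = B' := by
      rw [← Finset.erase_insert (hnot hB.2), ← Finset.erase_insert (hnot hB'.2)]
      exact congrArg (fun s => s.erase w) h
    subst h'
    obtain rfl : d = d' :=
      (Finset.mem_powersetCard.1 hB.2).2.symm.trans (Finset.mem_powersetCard.1 hB'.2).2
    rfl

/-- The sizes of the fibres of a partial function. -/
def fibreCard {α β : Type*} [Fintype α] [DecidableEq β] (c : α → Option β) (b : β) : ℕ :=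
  (Finset.univ.filter fun u => c u = some b).card

/-- An embedding of `Σ b, Fin (r b)` into `α` amounts to a partial function with fibre sizes `r`
together with an enumeration of each fibre. Injectivity of this correspondence suffices for the
bound. -/
theorem descFactorial_le_card_fibreCard_eq_mul {α β : Type*} [Fintype α] [Fintype β]
    [DecidableEq α] [DecidableEq β] (r : β → ℕ) :
    (Fintype.card α).descFactorial (∑ b, r b) ≤
      (Finset.univ.filter fun c : α → Option β => fibreCard c = r).card * ∏ b, (r b).factorial := by
  classical
  have h1 : (Fintype.card α).descFactorial (∑ b, r b) =
      Fintype.card ((Σ b, Fin (r b)) ↪ α) := by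
    rw [Fintype.card_embedding_eq]; simp
  have h2 : Fintype.card (Σ c : {c : α → Option β // fibreCard c = r},
      ∀ b, Fin (r b) ↪ {u // c.1 u = some b}) =
      (Finset.univ.filter fun c : α → Option β => fibreCard c = r).card *
        ∏ b, (r b).factorial := by
    rw [Fintype.card_sigma, Finset.sum_congr rfl (g := fun _ => ∏ b, (r b).factorial),
      Finset.sum_const, Finset.card_univ, Fintype.card_subtype, smul_eq_mul]
    intro c _
    rw [Fintype.card_pi]
    refine Finset.prod_congr rfl fun b _ => ?_
    have : Fintype.card {u // c.1 u = some b} = r b := by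
      rw [Fintype.card_subtype]; exact congrFun c.2 b
    rw [Fintype.card_embedding_eq, this, Fintype.card_fin, Nat.descFactorial_self]
  rw [h1, ← h2]
  -- The partial function of `e` gives each point of the image the label of its preimage.
  let col : ((Σ b, Fin (r b)) ↪ α) → α → Option β := fun e u =>
    if h : ∃ x, e x = u then some h.choose.1 else none
  have hcol : ∀ e x, col e (e x) = some x.1 := by
    intro e x
    have h : ∃ y, e y = e x := ⟨x, rfl⟩
    have : h.choose = x := e.injective h.choose_spec
    simp only [col]
    rw [dif_pos h, this]
  have hcol' : ∀ e u b, col e u = some b → ∃ i, e ⟨b, i⟩ = u := by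
    intro e u b h
    simp only [col] at h
    split_ifs at h with hx
    obtain ⟨x, rfl⟩ := hx
    have h' := hcol e x
    simp only [col] at h'
    rw [dif_pos ⟨x, rfl⟩, h] at h'
    obtain rfl := Option.some_injective _ h'
    exact ⟨x.2, rfl⟩
  have hfib : ∀ e, fibreCard (col e) = r := by
    intro e
    funext b
    have : (Finset.univ.filter fun u => col e u = some b) =
        Finset.univ.map ⟨fun i : Fin (r b) => e ⟨b, i⟩, fun i j h => by
          simpa using e.injective h⟩ := by
      ext u
      simp only [Finset.mem_filter, Finset.mem_univ, true_and, Finset.mem_map]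
      exact ⟨hcol' e u b, by rintro ⟨i, rfl⟩; exact hcol e _⟩
    rw [fibreCard, this, Finset.card_map, Finset.card_univ, Fintype.card_fin]
  refine Fintype.card_le_of_injective
    (fun e => ⟨⟨col e, hfib e⟩, fun b => ⟨fun i => ⟨e ⟨b, i⟩, hcol e ⟨b, i⟩⟩, fun i j h => by
      simpa using e.injective (Subtype.ext_iff.1 h)⟩⟩) ?_
  intro e e' h
  -- Stated for whole dependent pairs, so that substitution avoids a heterogeneous equality of the
  -- enumerations.
  have hval : ∀ x y : (Σ c : {c : α → Option β // fibreCard c = r},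
      ∀ b, Fin (r b) ↪ {u // c.1 u = some b}), x = y → ∀ b i, (x.2 b i).1 = (y.2 b i).1 := by
    rintro x _ rfl b i; rfl
  ext ⟨b, i⟩
  exact hval _ _ h b i

theorem sum_descFactorial_mul_le_sum_fibreCard {α β : Type*} [Fintype α] [Fintype β]
    [DecidableEq α] [DecidableEq β] {g : (β → ℕ) → ℝ} (hg : ∀ r, 0 ≤ g r) (K : ℕ) :
    ∑ r ∈ Fintype.piFinset fun _ : β => Finset.range K,
      ((Fintype.card α).descFactorial (∑ b, r b) : ℝ) / (∏ b, ((r b).factorial : ℝ)) * g r ≤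
    ∑ c : α → Option β, g (fibreCard c) := by
  classical
  calc _ ≤ ∑ r ∈ Fintype.piFinset fun _ : β => Finset.range K,
        ∑ c : α → Option β with fibreCard c = r, g (fibreCard c) := by
        refine Finset.sum_le_sum fun r _ => ?_
        rw [Finset.sum_congr rfl (g := fun _ => g r), Finset.sum_const, nsmul_eq_mul]
        · refine mul_le_mul_of_nonneg_right ?_ (hg r)
          rw [div_le_iff₀ (Finset.prod_pos fun b _ => by positivity)]
          exact_mod_cast descFactorial_le_card_fibreCard_eq_mul (α := α) r
        · intro c hc
          rw [(Finset.mem_filter.1 hc).2]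
    _ ≤ _ := by
        refine (Finset.sum_fiberwise_le_sum_of_sum_fiber_nonneg fun r _ => ?_)
        exact Finset.sum_nonneg fun c _ => hg _

/-! ### Tree-shaped neighbourhoods of a receiver -/

section Cylinder

variable {N : ℕ} {v : Fin N} {S : Finset (Fin N)}

/-- The receivers other than `v` that are assigned to a sender. -/
abbrev Explored (a : {w : Fin N // w ≠ v} → Option S) : Type := {w // (a w).isSome}

/-- The set formed by `v` and the receivers assigned to the sender `u`. -/
def assignedSet (a : {w : Fin N // w ≠ v} → Option S) (u : S) : Finset (Fin N) :=
  insert v ((Finset.univ.filter fun w => a w = some u).map (Function.Embedding.subtype _))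

/-- The set formed by `v` and the receivers assigned to some sender. -/
def exploredSet (a : {w : Fin N // w ≠ v} → Option S) : Finset (Fin N) :=
  insert v ((Finset.univ.filter fun w => (a w).isSome).map (Function.Embedding.subtype _))

/-- The set of explored receivers given by an optional one. -/
def traceSet {a : {w : Fin N // w ≠ v} → Option S} : Option (Explored a) → Finset (Fin N)
  | none => ∅
  | some w => {w.1.1}

/-- The event that the senders in `S` have the neighbourhoods given by `a`, and that the other
senders meet the explored receivers as told by `c`. -/
def Cylinder (a : {w : Fin N // w ≠ v} → Option S) (c : {u // u ∉ S} → Option (Explored a))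
    (G : BipGraph N) : Prop :=
  (∀ u : S, G u = assignedSet a u) ∧ ∀ u : {u // u ∉ S}, G u ∩ exploredSet a = traceSet (c u)

/-- The probability that the uniformly chosen element among those of minimal degree is a given
one, if this one has degree `k` and the degrees of the others are `r i`. -/
noncomputable def tieProb {ι : Type*} [Fintype ι] (k : ℕ) (r : ι → ℕ) : ℝ :=
  if ∀ i, k ≤ r i then (1 + ((Finset.univ.filter fun i => r i = k).card : ℝ))⁻¹ else 0

theorem tieProb_nonneg {ι : Type*} [Fintype ι] (k : ℕ) (r : ι → ℕ) : 0 ≤ tieProb k r := by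
  unfold tieProb; positivity

theorem tieProb_le_one {ι : Type*} [Fintype ι] (k : ℕ) (r : ι → ℕ) : tieProb k r ≤ 1 := by
  unfold tieProb
  split_ifs
  · exact inv_le_one_of_one_le₀ (le_add_of_nonneg_right (Nat.cast_nonneg _))
  · exact zero_le_one

/-- The receivers assigned to a sender are explored. -/
def toExplored (a : {w : Fin N // w ≠ v} → Option S) (u : S) (w : {w // a w = some u}) :
    Explored a := ⟨w.1, by rw [w.2]; rfl⟩

/-- The probability that `v` receives a grant on a cylinder. -/
noncomputable def cylinderGranted (k : ℕ) (a : {w : Fin N // w ≠ v} → Option S)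
    (r : Explored a → ℕ) : ℝ :=
  1 - ∏ u, (1 - tieProb k fun w => r (toExplored a u w))

theorem cylinderGranted_nonneg (k : ℕ) (a : {w : Fin N // w ≠ v} → Option S)
    (r : Explored a → ℕ) : 0 ≤ cylinderGranted k a r :=
  sub_nonneg.2 (Finset.prod_le_one (fun _ _ => sub_nonneg.2 (tieProb_le_one _ _))
    fun _ _ => sub_le_self _ (tieProb_nonneg _ _))

theorem mem_assignedSet_self (a : {w : Fin N // w ≠ v} → Option S) (u : S) :
    v ∈ assignedSet a u := Finset.mem_insert_self _ _

theorem coe_mem_assignedSet {a : {w : Fin N // w ≠ v} → Option S} {u : S}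
    {w : {w : Fin N // w ≠ v}} : w.1 ∈ assignedSet a u ↔ a w = some u := by
  simp [assignedSet, w.2]

theorem mem_exploredSet_self (a : {w : Fin N // w ≠ v} → Option S) :
    v ∈ exploredSet a := Finset.mem_insert_self _ _

theorem coe_mem_exploredSet {a : {w : Fin N // w ≠ v} → Option S}
    {w : {w : Fin N // w ≠ v}} : w.1 ∈ exploredSet a ↔ (a w).isSome := by
  simp [exploredSet, w.2]

variable {a : {w : Fin N // w ≠ v} → Option S} {c : {u // u ∉ S} → Option (Explored a)}
  {G : BipGraph N}

theorem notMem_traceSet_self (o : Option (Explored a)) : v ∉ traceSet o := by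
  cases o with
  | none => simp [traceSet]
  | some w => simpa [traceSet] using w.1.2.symm

theorem coe_mem_traceSet {o : Option (Explored a)} {w : Explored a} :
    w.1.1 ∈ traceSet o ↔ o = some w := by
  cases o with
  | none => simp [traceSet]
  | some w' =>
    simp only [traceSet, Finset.mem_singleton, Option.some.injEq, ← Subtype.ext_iff]
    exact eq_comm

theorem Cylinder.mem_self_iff (h : Cylinder a c G) (u : Fin N) : v ∈ G u ↔ u ∈ S := by
  by_cases hu : u ∈ S
  · simp [hu, h.1 ⟨u, hu⟩, mem_assignedSet_self]
  · have h2 := h.2 ⟨u, hu⟩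
    simp only [hu, iff_false]
    intro hv
    have : v ∈ G u ∩ exploredSet a := Finset.mem_inter.2 ⟨hv, mem_exploredSet_self a⟩
    rw [h2] at this
    exact notMem_traceSet_self _ this

theorem Cylinder.mem_iff_of_mem (h : Cylinder a c G) (u : S) (w : {w : Fin N // w ≠ v}) :
    w.1 ∈ G u ↔ a w = some u := by
  rw [h.1 u, coe_mem_assignedSet]

theorem Cylinder.mem_iff_of_notMem (h : Cylinder a c G) (u : {u // u ∉ S}) (w : Explored a) :
    w.1.1 ∈ G u ↔ c u = some w := by
  rw [← coe_mem_traceSet, ← h.2 u, Finset.mem_inter, and_iff_left]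
  exact coe_mem_exploredSet.2 w.2

theorem Cylinder.receiverDegree_self (h : Cylinder a c G) : receiverDegree G v = S.card := by
  unfold receiverDegree
  congr 1
  ext u
  simp [h.mem_self_iff]

/-- The summand `1` is the sender in `S` to which `w` is assigned, unique because `a` is a function;
the senders outside `S` are counted by `c`. -/
theorem Cylinder.receiverDegree_explored (h : Cylinder a c G) (w : Explored a) :
    receiverDegree G w.1.1 = 1 + fibreCard c w := by
  classical
  unfold receiverDegree fibreCard
  rw [Finset.card_filter, Finset.card_filter,
    ← Fintype.sum_subtype_add_sum_subtype (fun u => u ∈ S) fun u => if w.1.1 ∈ G u then (1 : ℕ) else 0]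
  congr 1
  · obtain ⟨u, hu⟩ := Option.isSome_iff_exists.1 w.2
    rw [Finset.sum_eq_single u (fun u' _ hu' => ?_) (fun hn => (hn (by simp)).elim), if_pos]
    · rw [h.mem_iff_of_mem u w.1, hu]
    · rw [if_neg]
      rw [h.mem_iff_of_mem u' w.1, hu]
      exact fun h => hu' (Option.some_injective _ h).symm
  · exact Finset.sum_congr rfl fun u _ => by simp only [h.mem_iff_of_notMem u w]

/-- The degrees being compared are `k + 1` for `v` and `1 + fibreCard c w` for a competitor; the
ones cancel, so `k` is compared with the fibre sizes. -/
theorem Cylinder.grantProb_of_mem (h : Cylinder a c G) {k : ℕ} (hk : S.card = k + 1) (u : S) :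
    grantProb G v u = tieProb k fun w => fibreCard c (toExplored a u w) := by
  have hG := h.1 u
  have hdeg : ∀ w : {w // a w = some u},
      receiverDegree G w.1.1 = 1 + fibreCard c (toExplored a u w) :=
    fun w => h.receiverDegree_explored (toExplored a u w)
  have hv : v ∈ G u := (h.mem_self_iff u).2 u.2
  have hmem : ∀ x, x ∈ G u ↔ x = v ∨ ∃ w : {w // a w = some u}, w.1.1 = x := by
    intro x
    by_cases hx : x = v
    · simp [hx, hv]
    · rw [h.mem_iff_of_mem u ⟨x, hx⟩]
      simp only [hx, false_or]
      exact ⟨fun h => ⟨⟨⟨x, hx⟩, h⟩, rfl⟩, by rintro ⟨w, rfl⟩; exact w.2⟩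
  have hiff : v ∈ minDegreeNeighbours G u ↔ ∀ w, k ≤ fibreCard c (toExplored a u w) := by
    simp only [minDegreeNeighbours, Finset.mem_filter, hv, true_and]
    constructor
    · intro H w
      have := H w.1.1 ((hmem _).2 (Or.inr ⟨w, rfl⟩))
      rw [h.receiverDegree_self, hdeg w] at this
      omega
    · intro H x hx
      rcases (hmem x).1 hx with rfl | ⟨w, rfl⟩
      · exact le_rfl
      · rw [h.receiverDegree_self, hdeg w]
        have := H w
        omega
  unfold grantProb tieProb
  by_cases hmin : v ∈ minDegreeNeighbours G u
  · rw [if_pos hmin, if_pos (hiff.1 hmin)]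
    congr 1
    have hset : minDegreeNeighbours G u = insert v ((Finset.univ.filter fun w =>
        fibreCard c (toExplored a u w) = k).map
          ⟨fun w => w.1.1, Subtype.val_injective.comp Subtype.val_injective⟩) := by
      have hmin' := (Finset.mem_filter.1 hmin).2
      ext x
      simp only [Finset.mem_insert, Finset.mem_map, Finset.mem_filter, Finset.mem_univ, true_and,
        Function.Embedding.coeFn_mk]
      constructor
      · intro hx
        have hx' := Finset.mem_filter.1 hx
        rcases (hmem x).1 hx'.1 with rfl | ⟨w, rfl⟩
        · exact Or.inl rfl
        · refine Or.inr ⟨w, ?_, rfl⟩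
          have h1 := hx'.2 v hv
          have h2 := hiff.1 hmin w
          rw [h.receiverDegree_self, hdeg w] at h1
          omega
      · rintro (rfl | ⟨w, hw, rfl⟩)
        · exact hmin
        · refine Finset.mem_filter.2 ⟨(hmem _).2 (Or.inr ⟨w, rfl⟩), fun y hy => ?_⟩
          have := hmin' y hy
          rw [h.receiverDegree_self] at this
          change receiverDegree G w.1.1 ≤ _
          rw [hdeg w]
          omega
    rw [hset, Finset.card_insert_of_notMem, Finset.card_map, add_comm]
    · push_cast; rfl
    · simp only [Finset.mem_map, not_exists, not_and]
      exact fun w _ hw => w.1.2 hw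
  · rw [if_neg hmin, if_neg fun H => hmin (hiff.2 H)]

theorem Cylinder.grantedProb_eq (h : Cylinder a c G) {k : ℕ} (hk : S.card = k + 1) :
    grantedProb G v = cylinderGranted k a (fibreCard c) := by
  classical
  unfold grantedProb cylinderGranted
  rw [← Fintype.prod_subtype_mul_prod_subtype (fun u => u ∈ S) fun u => 1 - grantProb G v u]
  congr 1
  rw [Finset.prod_eq_one (s := (Finset.univ : Finset {u // u ∉ S})), mul_one]
  · exact Finset.prod_congr (by ext; simp) fun u _ => by rw [h.grantProb_of_mem hk u]
  · intro u _
    rw [grantProb, if_neg, sub_zero]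
    exact fun hv => u.2 ((h.mem_self_iff u).1 (Finset.mem_filter.1 hv).1)

/-- Distinct cylinders are disjoint: a graph determines `S`, then `a`, then `c`. There are three
lemmas because the type of each item depends on the preceding ones. -/
theorem Cylinder.support_eq {S' : Finset (Fin N)} {a' : {w : Fin N // w ≠ v} → Option S'}
    {c' : {u // u ∉ S'} → Option (Explored a')} (h : Cylinder a c G) (h' : Cylinder a' c' G) :
    S = S' := by
  ext u
  rw [← h.mem_self_iff, h'.mem_self_iff]

theorem Cylinder.assignment_eq {a' : {w : Fin N // w ≠ v} → Option S}
    {c' : {u // u ∉ S} → Option (Explored a')} (h : Cylinder a c G) (h' : Cylinder a' c' G) :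
    a = a' := by
  funext w
  ext u
  rw [← h.mem_iff_of_mem, h'.mem_iff_of_mem]

theorem Cylinder.trace_eq {c' : {u // u ∉ S} → Option (Explored a)} (h : Cylinder a c G)
    (h' : Cylinder a c' G) : c = c' := by
  funext u
  ext w
  rw [← h.mem_iff_of_notMem, h'.mem_iff_of_notMem]

end Cylinder

theorem sum_le_of_unique_ne_zero {ι : Type*} {s : Finset ι} {f : ι → ℝ} {y : ℝ} (hy : 0 ≤ y)
    (hf : ∀ i ∈ s, f i ≤ y) (hu : ∀ i ∈ s, ∀ j ∈ s, f i ≠ 0 → f j ≠ 0 → i = j) :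
    ∑ i ∈ s, f i ≤ y := by
  by_cases h : ∃ i ∈ s, f i ≠ 0
  · obtain ⟨i, hi, h0⟩ := h
    rw [Finset.sum_eq_single_of_mem i hi]
    · exact hf i hi
    · intro j hj hji
      by_contra hne
      exact hji (hu j hj i hi hne h0)
  · push Not at h
    rwa [Finset.sum_eq_zero h]

-- By disjointness at most one term is nonzero, and it equals the right-hand side. Graphs in no
-- cylinder contribute zero, which is harmless as `grantedProb` is nonnegative.
open Classical in
theorem sum_cylinder_le_grantedProb {N : ℕ} (v : Fin N) (G : BipGraph N) (n : ℕ) :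
    ∑ k ∈ Finset.range n, ∑ S ∈ Finset.powersetCard (k + 1) (Finset.univ : Finset (Fin N)),
      ∑ a : {w : Fin N // w ≠ v} → Option S, ∑ c : {u // u ∉ S} → Option (Explored a),
        (if Cylinder a c G then cylinderGranted k a (fibreCard c) else 0) ≤ grantedProb G v := by
  have hG := grantedProb_nonneg G v
  have key : ∀ {S : Finset (Fin N)} {k : ℕ} {a : {w : Fin N // w ≠ v} → Option S}
      {c : {u // u ∉ S} → Option (Explored a)},
      (if Cylinder a c G then cylinderGranted k a (fibreCard c) else 0) ≠ 0 → Cylinder a c G := by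
    intro S k a c h
    by_contra h'
    exact h (if_neg h')
  have key2 : ∀ {S : Finset (Fin N)} {k : ℕ} {a : {w : Fin N // w ≠ v} → Option S},
      (∑ c : {u // u ∉ S} → Option (Explored a),
        (if Cylinder a c G then cylinderGranted k a (fibreCard c) else 0)) ≠ 0 →
      ∃ c, Cylinder a c G := by
    intro S k a h
    obtain ⟨c, _, hc⟩ := Finset.exists_ne_zero_of_sum_ne_zero h
    exact ⟨c, key hc⟩
  have key3 : ∀ {S : Finset (Fin N)} {k : ℕ},
      (∑ a : {w : Fin N // w ≠ v} → Option S, ∑ c : {u // u ∉ S} → Option (Explored a),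
        (if Cylinder a c G then cylinderGranted k a (fibreCard c) else 0)) ≠ 0 →
      ∃ a : {w : Fin N // w ≠ v} → Option S, ∃ c, Cylinder a c G := by
    intro S k h
    obtain ⟨a, _, ha⟩ := Finset.exists_ne_zero_of_sum_ne_zero h
    exact ⟨a, key2 ha⟩
  refine sum_le_of_unique_ne_zero hG (fun k _ => sum_le_of_unique_ne_zero hG (fun S hS =>
    sum_le_of_unique_ne_zero hG (fun a _ => sum_le_of_unique_ne_zero hG (fun c _ => ?_) ?_) ?_)
      ?_) ?_
  · split_ifs with h
    · exact (h.grantedProb_eq (Finset.mem_powersetCard.1 hS).2).ge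
    · exact hG
  · intro c _ c' _ h h'
    exact (key h).trace_eq (key h')
  · intro a _ a' _ h h'
    obtain ⟨c, hc⟩ := key2 h
    obtain ⟨c', hc'⟩ := key2 h'
    exact hc.assignment_eq hc'
  · intro S _ S' _ h h'
    obtain ⟨a, c, hc⟩ := key3 h
    obtain ⟨a', c', hc'⟩ := key3 h'
    exact hc.support_eq hc'
  · intro k _ k' _ h h'
    obtain ⟨S, hS, h⟩ := Finset.exists_ne_zero_of_sum_ne_zero h
    obtain ⟨S', hS', h'⟩ := Finset.exists_ne_zero_of_sum_ne_zero h'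
    obtain ⟨a, c, hc⟩ := key3 h
    obtain ⟨a', c', hc'⟩ := key3 h'
    have := hc.support_eq hc'
    subst this
    have h1 := (Finset.mem_powersetCard.1 hS).2
    have h2 := (Finset.mem_powersetCard.1 hS').2
    omega

-- A cylinder imposes one condition on each sender separately, and the senders are independent.
open Classical in
theorem expect_cylinder (D : PMF ℕ) {N : ℕ} {v : Fin N} {S : Finset (Fin N)}
    (a : {w : Fin N // w ≠ v} → Option S) (c : {u // u ∉ S} → Option (Explored a)) :
    expect (outGraphLaw D N) (fun G => if Cylinder a c G then 1 else 0) =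
      (∏ u : S, neighbourhoodMass D N (assignedSet a u)) *
        ∏ u, traceMass D (exploredSet a) (traceSet (c u)) := by
  let X : Fin N → Finset (Fin N) → ℝ := fun u A =>
    if h : u ∈ S then (if A = assignedSet a ⟨u, h⟩ then 1 else 0)
    else if A ∩ exploredSet a = traceSet (c ⟨u, h⟩) then 1 else 0
  have hX : ∀ G : BipGraph N, (if Cylinder a c G then (1 : ℝ) else 0) = ∏ u, X u (G u) := by
    intro G
    by_cases h : Cylinder a c G
    · rw [if_pos h, Finset.prod_eq_one]
      intro u _
      by_cases hu : u ∈ S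
      · simp only [X, dif_pos hu]
        exact if_pos (h.1 ⟨u, hu⟩)
      · simp only [X, dif_neg hu]
        exact if_pos (h.2 ⟨u, hu⟩)
    · rw [if_neg h]
      symm
      rw [Cylinder, not_and_or] at h
      rcases h with h | h <;> push Not at h <;> obtain ⟨u, hu⟩ := h
      · refine Finset.prod_eq_zero (Finset.mem_univ u.1) ?_
        simp only [X, dif_pos u.2]
        exact if_neg hu
      · refine Finset.prod_eq_zero (Finset.mem_univ u.1) ?_
        simp only [X, dif_neg u.2]
        exact if_neg hu
  simp_rw [hX]
  rw [outGraphLaw, expect_indepLaw_prod, ← Fintype.prod_subtype_mul_prod_subtype (fun u => u ∈ S)]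
  congr 1
  · refine Finset.prod_congr (by ext; simp) fun u _ => ?_
    simp only [X, u.2, dif_pos]
    simp [expect, neighbourhoodMass]
  · refine Finset.prod_congr rfl fun u _ => ?_
    simp only [X, u.2, not_false_eq_true, dif_neg]
    simp [expect, neighbourhoodMass, traceMass, Finset.sum_filter]

theorem sum_cylinder_le_expect_grantedProb (D : PMF ℕ) {N : ℕ} (v : Fin N) (n : ℕ) :
    ∑ k ∈ Finset.range n, ∑ S ∈ Finset.powersetCard (k + 1) (Finset.univ : Finset (Fin N)),
      ∑ a : {w : Fin N // w ≠ v} → Option S, ∑ c : {u // u ∉ S} → Option (Explored a),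
        (∏ u : S, neighbourhoodMass D N (assignedSet a u)) *
        (∏ u, traceMass D (exploredSet a) (traceSet (c u))) * cylinderGranted k a (fibreCard c) ≤
      expect (outGraphLaw D N) fun G => grantedProb G v := by
  classical
  refine le_trans (le_of_eq ?_) (expect_mono _ fun G => sum_cylinder_le_grantedProb v G n)
  simp_rw [expect_sum]
  refine Finset.sum_congr rfl fun k _ => Finset.sum_congr rfl fun S _ =>
    Finset.sum_congr rfl fun a _ => Finset.sum_congr rfl fun c _ => ?_
  rw [← expect_cylinder, ← expect_mul_const]
  simp only [ite_mul, one_mul, zero_mul]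

/-! ### Breaking ties, and summation over cylinders -/

/-- The closed form of the mean of `tieProb` over `e` other neighbours: `q` is the probability
of a tie with one of them and `b` the probability that one of them has a larger degree. -/
noncomputable def tieMean (q b : ℝ) (e : ℕ) : ℝ :=
  ((q + b) ^ (e + 1) - b ^ (e + 1)) / ((e + 1) * q)

/-- With `j` ties, `1 / (1 + j)` is the integral of `t ^ j` over `[0, 1]`. Under the integral the
sum factorises: each competitor contributes `p k * t` for a tie and `b` for a larger degree. -/
theorem sum_prod_mul_tieProb {ι : Type*} [Fintype ι] [DecidableEq ι] {k K : ℕ} (hk : k < K)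
    {p : ℕ → ℝ} (hq : p k ≠ 0) :
    ∑ r ∈ Fintype.piFinset fun _ : ι => Finset.range K, (∏ i, p (r i)) * tieProb k r =
      tieMean (p k) (∑ j ∈ Finset.Ico (k + 1) K, p j) (Fintype.card ι) := by
  set b := ∑ j ∈ Finset.Ico (k + 1) K, p j with hb
  have h1 : ∑ r ∈ Fintype.piFinset fun _ : ι => Finset.range K, (∏ i, p (r i)) * tieProb k r =
      ∑ r ∈ Fintype.piFinset fun _ : ι => Finset.Ico k K,
        ∫ t in (0 : ℝ)..1, ∏ i, (p (r i) * if r i = k then t else 1) := by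
    symm
    refine (Finset.sum_congr rfl fun r hr => ?_).trans (Finset.sum_subset
      (s₁ := Fintype.piFinset fun _ : ι => Finset.Ico k K)
      (f := fun r => (∏ i, p (r i)) * tieProb k r) ?_ ?_)
    · have hr' : ∀ i, k ≤ r i := fun i =>
        (Finset.mem_Ico.1 (Fintype.mem_piFinset.1 hr i)).1
      simp_rw [Finset.prod_mul_distrib]
      rw [intervalIntegral.integral_const_mul]
      congr 1
      simp_rw [Finset.prod_ite, Finset.prod_const, one_pow, mul_one]
      rw [integral_pow, tieProb, if_pos hr']
      simp [add_comm]
    · exact Fintype.piFinset_subset _ _ fun i j hj =>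
        Finset.mem_range.2 (Finset.mem_Ico.1 hj).2
    · intro r hr hr'
      simp only [Fintype.mem_piFinset, Finset.mem_range, Finset.mem_Ico] at hr hr'
      rw [tieProb, if_neg, mul_zero]
      exact fun H => hr' fun i => ⟨H i, hr i⟩
  rw [h1, ← intervalIntegral.integral_finsetSum]
  · have h2 : ∀ t : ℝ, ∑ r ∈ Fintype.piFinset fun _ : ι => Finset.Ico k K,
        ∏ i, (p (r i) * if r i = k then t else 1) = (b + p k * t) ^ Fintype.card ι := by
      intro t
      rw [← Finset.prod_univ_sum (fun _ => Finset.Ico k K)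
        (fun _ j => p j * if j = k then t else 1), Finset.prod_const, Finset.card_univ,
        Finset.sum_eq_sum_Ico_succ_bot hk, if_pos rfl, hb, add_comm]
      congr 2
      refine Finset.sum_congr rfl fun j hj => ?_
      rw [if_neg (by have := Finset.mem_Ico.1 hj; omega), mul_one]
    simp_rw [h2]
    rw [intervalIntegral.integral_comp_add_mul (fun x => x ^ Fintype.card ι) hq, integral_pow,
      tieMean]
    simp only [mul_zero, add_zero, mul_one, smul_eq_mul]
    rw [add_comm b, inv_mul_eq_div, div_div]
  · intro r _
    refine Continuous.intervalIntegrable ?_ _ _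
    refine continuous_finsetProd _ fun i _ => ?_
    split_ifs <;> fun_prop

/-- Independence of the branches: `κ` splits into blocks `ι u`, and the summand is a product over
the blocks. -/
theorem sum_piFinset_sigma {U κ : Type*} {ι : U → Type*} [Fintype U] [DecidableEq U]
    [∀ u, Fintype (ι u)] [∀ u, DecidableEq (ι u)] [Fintype κ] [DecidableEq κ]
    (f : (u : U) → ι u → κ) (hf : Function.Bijective fun x : Σ u, ι u => f x.1 x.2)
    (t : Finset ℕ) (p : ℕ → ℝ) (X : (u : U) → (ι u → ℕ) → ℝ) :
    ∑ r ∈ Fintype.piFinset fun _ : κ => t, (∏ w, p (r w)) * ∏ u, X u (fun i => r (f u i)) =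
      ∏ u, ∑ r ∈ Fintype.piFinset fun _ : ι u => t, (∏ i, p (r i)) * X u r := by
  rw [Finset.prod_univ_sum]
  let e := Equiv.ofBijective _ hf
  have he : ∀ x, e x = f x.1 x.2 := fun _ => rfl
  have he' : ∀ u i, e.symm (f u i) = ⟨u, i⟩ := fun u i => e.symm_apply_apply ⟨u, i⟩
  refine Finset.sum_nbij' (fun r u i => r (f u i)) (fun q w => q (e.symm w).1 (e.symm w).2)
    ?_ ?_ ?_ ?_ ?_
  · intro r hr
    simp only [Fintype.mem_piFinset] at hr ⊢
    exact fun u i => hr _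
  · intro q hq
    simp only [Fintype.mem_piFinset] at hq ⊢
    exact fun w => hq _ _
  · intro r _
    funext w
    change r (e (e.symm w)) = r w
    rw [e.apply_symm_apply]
  · intro q _
    funext u i
    change q (e.symm (f u i)).1 (e.symm (f u i)).2 = q u i
    rw [he']
  · intro r _
    rw [Finset.prod_mul_distrib]
    congr 1
    rw [← Fintype.prod_equiv e (fun x => p (r (f x.1 x.2))) _ (fun x => by rw [he]),
      Fintype.prod_sigma]

section

variable {N : ℕ} {v : Fin N} {S : Finset (Fin N)}

theorem bijective_toExplored (a : {w : Fin N // w ≠ v} → Option S) :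
    Function.Bijective fun x : Σ u, {w // a w = some u} => toExplored a x.1 x.2 := by
  constructor
  · rintro ⟨u, w, hw⟩ ⟨u', w', hw'⟩ h
    obtain rfl : w = w' := congrArg Subtype.val h
    obtain rfl : u = u' := Option.some_injective _ (hw.symm.trans hw')
    rfl
  · rintro ⟨w, hw⟩
    obtain ⟨u, hu⟩ := Option.isSome_iff_exists.1 hw
    exact ⟨⟨u, w, hu⟩, rfl⟩

theorem card_fibre (a : {w : Fin N // w ≠ v} → Option S) (u : S) :
    Fintype.card {w // a w = some u} = fibreCard a u := Fintype.card_subtype _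

theorem card_explored (a : {w : Fin N // w ≠ v} → Option S) :
    Fintype.card (Explored a) = ∑ u, fibreCard a u := by
  rw [← Fintype.card_of_bijective (bijective_toExplored a), Fintype.card_sigma]
  simp_rw [card_fibre]

theorem card_exploredSet (a : {w : Fin N // w ≠ v} → Option S) :
    (exploredSet a).card = Fintype.card (Explored a) + 1 := by
  rw [exploredSet, Finset.card_insert_of_notMem, Finset.card_map, Fintype.card_subtype]
  simp

theorem card_assignedSet (a : {w : Fin N // w ≠ v} → Option S) (u : S) :
    (assignedSet a u).card = fibreCard a u + 1 := by
  rw [assignedSet, Finset.card_insert_of_notMem, Finset.card_map, fibreCard]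
  simp

/-- The truncated weights `p` need not have total mass one, so powers of their sum appear where a
probability law would give `1`. -/
theorem sum_prod_mul_cylinderGranted (a : {w : Fin N // w ≠ v} → Option S) {k K : ℕ}
    (hk : k < K) {p : ℕ → ℝ} (hq : p k ≠ 0) :
    ∑ r ∈ Fintype.piFinset fun _ : Explored a => Finset.range K,
      (∏ w, p (r w)) * cylinderGranted k a r =
    ∏ u, (∑ j ∈ Finset.range K, p j) ^ fibreCard a u -
      ∏ u, ((∑ j ∈ Finset.range K, p j) ^ fibreCard a u -
        tieMean (p k) (∑ j ∈ Finset.Ico (k + 1) K, p j) (fibreCard a u)) := by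
  have hone : ∀ u, ∑ r ∈ Fintype.piFinset fun _ : {w // a w = some u} => Finset.range K,
      ∏ i, p (r i) = (∑ j ∈ Finset.range K, p j) ^ fibreCard a u := by
    intro u
    rw [← Finset.prod_univ_sum (fun _ => Finset.range K) (fun _ j => p j), Finset.prod_const,
      Finset.card_univ, card_fibre]
  simp_rw [cylinderGranted, mul_sub, Finset.sum_sub_distrib]
  congr 1
  · have h := sum_piFinset_sigma (toExplored a) (bijective_toExplored a) (Finset.range K) p
      fun _ _ => 1
    simp only [Finset.prod_const_one, mul_one] at h
    simp only [mul_one]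
    rw [h]
    exact Finset.prod_congr rfl fun u _ => hone u
  · rw [sum_piFinset_sigma (toExplored a) (bijective_toExplored a) (Finset.range K) p
      fun u r => 1 - tieProb k r]
    refine Finset.prod_congr rfl fun u _ => ?_
    simp_rw [mul_sub, mul_one, Finset.sum_sub_distrib]
    rw [hone, sum_prod_mul_tieProb hk hq, card_fibre]

/-- A sender outside `S` that meets the explored set costs at least `q`. There are at most `N`
others, and their factor is at most one, so the exponent may be raised to `N`. -/
theorem pow_mul_pow_le_prod_traceMass (D : PMF ℕ) (a : {w : Fin N // w ≠ v} → Option S)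
    (c : {u // u ∉ S} → Option (Explored a)) {q : ℝ} (hq : 0 ≤ q)
    (h : ∀ w ∈ exploredSet a, q ≤ traceMass D (exploredSet a) {w}) :
    q ^ (∑ w, fibreCard c w) * traceMass D (exploredSet a) ∅ ^ N ≤
      ∏ u, traceMass D (exploredSet a) (traceSet (c u)) := by
  have h0 := traceMass_nonneg D (exploredSet a) ∅
  have h1 := traceMass_le_one D (exploredSet a) ∅
  have hsome : (Finset.univ.filter fun u => (c u).isSome).card = ∑ w, fibreCard c w := by
    rw [Finset.card_eq_sum_card_fiberwise (f := c) (t := Finset.univ) (by simp)]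
    rw [Fintype.sum_option]
    have : ((Finset.univ.filter fun u => (c u).isSome).filter fun u => c u = none) = ∅ := by
      ext u; cases h : c u <;> simp [h]
    rw [this, Finset.card_empty, zero_add]
    refine Finset.sum_congr rfl fun w _ => ?_
    unfold fibreCard
    congr 1
    ext u
    cases h : c u <;> simp [h]
  calc _ ≤ ∏ u, if (c u).isSome then q else traceMass D (exploredSet a) ∅ := by
        rw [Finset.prod_ite, Finset.prod_const, Finset.prod_const, hsome]
        refine mul_le_mul_of_nonneg_left ?_ (by positivity)
        refine pow_le_pow_of_le_one h0 h1 ((Finset.card_filter_le _ _).trans ?_)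
        rw [Finset.card_univ]
        simp
    _ ≤ _ := by
        refine Finset.prod_le_prod (fun u _ => by split_ifs <;> assumption) fun u _ => ?_
        cases hu : c u with
        | none => simp [traceSet]
        | some w => simpa [traceSet] using h w.1.1 (coe_mem_exploredSet.2 w.2)

end

/-! ### Comparison with the branching process -/

/-- Multiplicative errors `θ` and mean `μ` with which the random graph on `N` senders and `N`
receivers is approximated, around `L` vertices, by the branching process of mean `m`. -/
structure LocalApprox (D : PMF ℕ) (N n L : ℕ) (m μ θ : ℝ) : Prop where
  desc : ∀ R ≤ L, θ * (N : ℝ) ^ R ≤ (N - n).descFactorial R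
  empty : ∀ W : Finset (Fin N), W.card ≤ L → θ * Real.exp (-m) ^ W.card ≤ traceMass D W ∅ ^ N
  single : ∀ W : Finset (Fin N), W.card ≤ L → ∀ w ∈ W, μ / N ≤ traceMass D W {w}

section

variable {D : PMF ℕ} {N n L K k : ℕ} {m μ θ : ℝ} {v : Fin N} {S : Finset (Fin N)}

/-- Both bounds follow from reading `tieMean` as a sum of weights times `tieProb`, which lies in
`[0, 1]`. -/
theorem tieMean_nonneg_and_le_pow {p : ℕ → ℝ} (hp : ∀ j, 0 ≤ p j) (hk : k < K) (hq : p k ≠ 0)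
    (e : ℕ) :
    0 ≤ tieMean (p k) (∑ j ∈ Finset.Ico (k + 1) K, p j) e ∧
      tieMean (p k) (∑ j ∈ Finset.Ico (k + 1) K, p j) e ≤ (∑ j ∈ Finset.range K, p j) ^ e := by
  have h := sum_prod_mul_tieProb (ι := Fin e) hk hq
  rw [Fintype.card_fin] at h
  rw [← h]
  have hprod : ∀ r : Fin e → ℕ, 0 ≤ ∏ i, p (r i) := fun r => Finset.prod_nonneg fun i _ => hp _
  constructor
  · exact Finset.sum_nonneg fun r _ => mul_nonneg (hprod r) (tieProb_nonneg _ _)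
  · calc _ ≤ ∑ r ∈ Fintype.piFinset fun _ : Fin e => Finset.range K, ∏ i, p (r i) :=
          Finset.sum_le_sum fun r _ => mul_le_of_le_one_right (hprod r) (tieProb_le_one _ _)
      _ = _ := by
          rw [← Finset.prod_univ_sum (fun _ => Finset.range K) (fun _ j => p j),
            Finset.prod_const, Finset.card_univ, Fintype.card_fin]

/-- The choice of the senders gives `N ^ R`, which cancels against `(μ / N) ^ R`. One `θ` comes from
`desc`, one from `empty`. The extra `exp (-m)` belongs to `v`, which is explored but gets no further
sender. -/
theorem LocalApprox.le_sum_trace (h : LocalApprox D N n L m μ θ) (hN : 0 < N) (hμ : 0 ≤ μ)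
    (hθ : 0 ≤ θ) (hS : S.card ≤ n) (a : {w : Fin N // w ≠ v} → Option S)
    (h1 : Fintype.card (Explored a) + 1 ≤ L) (h2 : Fintype.card (Explored a) * K ≤ L) :
    θ ^ 2 * Real.exp (-m) * ∑ r ∈ Fintype.piFinset fun _ : Explored a => Finset.range K,
      (∏ w, Real.exp (-m) * μ ^ r w / (r w).factorial) * cylinderGranted k a r ≤
    ∑ c : {u // u ∉ S} → Option (Explored a),
      (∏ u, traceMass D (exploredSet a) (traceSet (c u))) * cylinderGranted k a (fibreCard c) := by
  have hN' : (0 : ℝ) < N := by exact_mod_cast hN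
  have hc : (exploredSet a).card ≤ L := by rwa [card_exploredSet]
  set t := traceMass D (exploredSet a) ∅ with ht
  have ht0 : 0 ≤ t := traceMass_nonneg _ _ _
  have hcard : Fintype.card {u // u ∉ S} = N - S.card := by
    rw [Fintype.card_subtype_compl]; simp
  refine le_trans ?_ ((sum_descFactorial_mul_le_sum_fibreCard
    (g := fun r : Explored a → ℕ => (μ / N) ^ (∑ w, r w) * t ^ N * cylinderGranted k a r)
    (fun r => mul_nonneg (by positivity) (cylinderGranted_nonneg _ _ _)) K).trans
      (Finset.sum_le_sum fun c _ => mul_le_mul_of_nonneg_right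
        (pow_mul_pow_le_prod_traceMass D a c (by positivity) (h.single _ hc))
        (cylinderGranted_nonneg _ _ _)))
  rw [Finset.mul_sum]
  refine Finset.sum_le_sum fun r hr => ?_
  have hsum : ∑ w, r w ≤ L := by
    refine le_trans ?_ h2
    rw [← Finset.card_univ, ← smul_eq_mul]
    exact Finset.sum_le_card_nsmul _ _ _ fun w _ =>
      (Finset.mem_range.1 (Fintype.mem_piFinset.1 hr w)).le
  have hd : θ * (N : ℝ) ^ (∑ w, r w) ≤
      (Fintype.card {u // u ∉ S}).descFactorial (∑ w, r w) := by
    refine (h.desc _ hsum).trans ?_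
    rw [hcard]
    exact_mod_cast Nat.descFactorial_le _ (Nat.sub_le_sub_left hS N)
  have he := h.empty _ hc
  rw [card_exploredSet, ← ht] at he
  simp_rw [Finset.prod_div_distrib, Finset.prod_mul_distrib, Finset.prod_const,
    Finset.prod_pow_eq_pow_sum, Finset.card_univ]
  rw [← mul_assoc, ← mul_assoc]
  refine mul_le_mul_of_nonneg_right ?_ (cylinderGranted_nonneg _ _ _)
  have hf : (0 : ℝ) < ∏ w, ((r w).factorial : ℝ) := Finset.prod_pos fun w _ => by positivity
  calc _ = (θ * (N : ℝ) ^ (∑ w, r w) / (∏ w, ((r w).factorial : ℝ)) * (μ / N) ^ (∑ w, r w)) *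
        (θ * Real.exp (-m) ^ (Fintype.card (Explored a) + 1)) := by
        rw [div_pow]; field_simp; ring
    _ ≤ ((Fintype.card {u // u ∉ S}).descFactorial (∑ w, r w) / (∏ w, ((r w).factorial : ℝ)) *
        (μ / N) ^ (∑ w, r w)) * t ^ N := by gcongr
    _ = _ := by ring

/-- The weight of a neighbour with `e` other neighbours. -/
noncomputable def sizeBiasedMass (D : PMF ℕ) (e : ℕ) : ℝ := (D (e + 1)).toReal * (e + 1)

theorem sizeBiasedMass_nonneg (D : PMF ℕ) (e : ℕ) : 0 ≤ sizeBiasedMass D e :=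
  mul_nonneg ENNReal.toReal_nonneg (by positivity)

theorem inv_choose_ge {N r : ℕ} (h : r ≤ N) :
    (r.factorial : ℝ) / (N : ℝ) ^ r ≤ (N.choose r : ℝ)⁻¹ := by
  have hc : (0 : ℝ) < N.choose r := by exact_mod_cast Nat.choose_pos h
  have hf : (0 : ℝ) < r.factorial := by positivity
  rw [← inv_div]
  exact inv_anti₀ hc (Nat.choose_le_pow_div r N)

/-- A sender with `e` competitors has weight at least `D (e + 1) * (e + 1)! / N ^ (e + 1)`, and
choosing the competitors gives `N ^ e / e!`; the product is `sizeBiasedMass D e / N`. This choice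
costs the third `θ`. -/
theorem LocalApprox.le_sum_assignment (h : LocalApprox D N n L m μ θ) (hN : 0 < N) (hμ : 0 < μ)
    (hθ : 0 ≤ θ) (hS : S.card = k + 1) (hkn : k < n) (hkK : k < K) (hKN : K ≤ N)
    (hL : n * (K + 1) ^ 2 ≤ L) {p : ℕ → ℝ}
    (hp : ∀ r, p r = Real.exp (-m) * μ ^ r / r.factorial) :
    θ ^ 3 * Real.exp (-m) / (N : ℝ) ^ (k + 1) *
      ((∑ e ∈ Finset.range K, sizeBiasedMass D e * (∑ j ∈ Finset.range K, p j) ^ e) ^ (k + 1) -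
        (∑ e ∈ Finset.range K, sizeBiasedMass D e * ((∑ j ∈ Finset.range K, p j) ^ e -
          tieMean (p k) (∑ j ∈ Finset.Ico (k + 1) K, p j) e)) ^ (k + 1)) ≤
    ∑ a : {w : Fin N // w ≠ v} → Option S, ∑ c : {u // u ∉ S} → Option (Explored a),
      (∏ u : S, neighbourhoodMass D N (assignedSet a u)) *
      (∏ u, traceMass D (exploredSet a) (traceSet (c u))) * cylinderGranted k a (fibreCard c) := by
  have hN' : (0 : ℝ) < N := by exact_mod_cast hN
  have hp0 : ∀ r, 0 < p r := fun r => by rw [hp]; positivity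
  set τ := ∑ j ∈ Finset.range K, p j with hτ
  set T := tieMean (p k) (∑ j ∈ Finset.Ico (k + 1) K, p j) with hT
  have hTn := tieMean_nonneg_and_le_pow (fun j => (hp0 j).le) hkK (hp0 k).ne'
  rw [← hT, ← hτ] at hTn
  let Ψ : (S → ℕ) → ℝ := fun e => ∏ u, τ ^ e u - ∏ u, (τ ^ e u - T (e u))
  have hΨ : ∀ e, 0 ≤ Ψ e := fun e => sub_nonneg.2 <| Finset.prod_le_prod
    (fun u _ => sub_nonneg.2 (hTn _).2) fun u _ => sub_le_self _ (hTn _).1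
  -- Assignments with a large fibre get the value zero, because `LocalApprox` controls only explored
  -- sets of bounded size.
  let g : (S → ℕ) → ℝ := fun e => if ∀ u, e u < K then
    (∏ u, (D (e u + 1)).toReal * (N.choose (e u + 1) : ℝ)⁻¹) *
      (θ ^ 2 * Real.exp (-m) * Ψ e) else 0
  have hg : ∀ e, 0 ≤ g e := fun e => by
    have := hΨ e
    simp only [g]; split_ifs
    · exact mul_nonneg (Finset.prod_nonneg fun u _ =>
        mul_nonneg ENNReal.toReal_nonneg (by positivity)) (by positivity)
    · exact le_rfl
  have hsumle : ∀ e : S → ℕ, (∀ u, e u < K) → ∑ u, e u ≤ n * K := by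
    intro e he
    refine (Finset.sum_le_card_nsmul _ _ K fun u _ => (he u).le).trans ?_
    rw [Finset.card_univ, Fintype.card_coe, hS, smul_eq_mul]
    exact Nat.mul_le_mul_right _ hkn
  have hn : 1 ≤ n := by omega
  -- There are at most `n * K` explored receivers besides `v`, each with fewer than `K` further
  -- senders.
  have hexp : n * (K + 1) ^ 2 = n * K * K + 2 * (n * K) + n := by ring
  have hL1 : n * K + 1 ≤ L := by omega
  have hL2 : n * K * K ≤ L := by omega
  refine le_trans ?_ ((sum_descFactorial_mul_le_sum_fibreCard hg K).trans
    (Finset.sum_le_sum fun a _ => ?_))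
  · have hfac : (∑ e ∈ Finset.range K, sizeBiasedMass D e * τ ^ e) ^ (k + 1) -
        (∑ e ∈ Finset.range K, sizeBiasedMass D e * (τ ^ e - T e)) ^ (k + 1) =
        ∑ e ∈ Fintype.piFinset fun _ : S => Finset.range K,
          (∏ u, sizeBiasedMass D (e u)) * Ψ e := by
      have hpow : ∀ f : ℕ → ℝ, (∑ e ∈ Finset.range K, f e) ^ (k + 1) =
          ∑ e ∈ Fintype.piFinset fun _ : S => Finset.range K, ∏ u, f (e u) := by
        intro f
        rw [← Finset.prod_univ_sum (fun _ => Finset.range K) (fun _ j => f j), Finset.prod_const,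
          Finset.card_univ, Fintype.card_coe, hS]
      rw [hpow, hpow, ← Finset.sum_sub_distrib]
      refine Finset.sum_congr rfl fun e _ => ?_
      rw [Finset.prod_mul_distrib, Finset.prod_mul_distrib, mul_sub]
    rw [hfac, Finset.mul_sum]
    refine Finset.sum_le_sum fun e he => ?_
    have he' : ∀ u, e u < K := fun u => Finset.mem_range.1 (Fintype.mem_piFinset.1 he u)
    have hΨe := hΨ e
    simp only [g]
    rw [if_pos he']
    have hd : θ * (N : ℝ) ^ (∑ u, e u) ≤
        (Fintype.card {w : Fin N // w ≠ v}).descFactorial (∑ u, e u) := by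
      refine (h.desc _ ((hsumle e he').trans (by omega))).trans ?_
      have : Fintype.card {w : Fin N // w ≠ v} = N - 1 := by simp
      rw [this]
      exact_mod_cast Nat.descFactorial_le _ (Nat.sub_le_sub_left hn N)
    have hf : (0 : ℝ) < ∏ u, ((e u).factorial : ℝ) := Finset.prod_pos fun w _ => by positivity
    have hprod : (∏ u, ((e u).factorial : ℝ)) * (∏ u, sizeBiasedMass D (e u)) /
        ((N : ℝ) ^ (∑ u, e u) * (N : ℝ) ^ (k + 1)) ≤
        ∏ u, (D (e u + 1)).toReal * (N.choose (e u + 1) : ℝ)⁻¹ := by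
      have hcard : (N : ℝ) ^ (k + 1) = ∏ _u : S, (N : ℝ) := by
        rw [Finset.prod_const, Finset.card_univ, Fintype.card_coe, hS]
      rw [hcard, ← Finset.prod_pow_eq_pow_sum, ← Finset.prod_mul_distrib,
        ← Finset.prod_mul_distrib, ← Finset.prod_div_distrib]
      refine Finset.prod_le_prod (fun u _ => ?_) fun u _ => ?_
      · have := sizeBiasedMass_nonneg D (e u)
        positivity
      · have h1 := inv_choose_ge (show e u + 1 ≤ N from (he' u).trans_le hKN)
        calc _ = (D (e u + 1)).toReal * ((e u + 1).factorial / (N : ℝ) ^ (e u + 1)) := by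
              rw [sizeBiasedMass, Nat.factorial_succ, pow_succ]; push_cast; ring
          _ ≤ _ := mul_le_mul_of_nonneg_left h1 ENNReal.toReal_nonneg
    have hw : 0 ≤ ∏ u, sizeBiasedMass D (e u) :=
      Finset.prod_nonneg fun u _ => sizeBiasedMass_nonneg D _
    calc _ = θ * (N : ℝ) ^ (∑ u, e u) / (∏ u, ((e u).factorial : ℝ)) *
          ((∏ u, ((e u).factorial : ℝ)) * (∏ u, sizeBiasedMass D (e u)) /
            ((N : ℝ) ^ (∑ u, e u) * (N : ℝ) ^ (k + 1)) * (θ ^ 2 * Real.exp (-m) * Ψ e)) := by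
          field_simp
      _ ≤ _ := by gcongr
  · simp only [g]
    split_ifs with hlt
    · have hex : Fintype.card (Explored a) ≤ n * K := by
        rw [card_explored]; exact hsumle _ hlt
      have h1 := h.le_sum_trace (k := k) (K := K) hN hμ.le hθ (by omega) a (by omega)
        ((Nat.mul_le_mul_right K hex).trans hL2)
      simp_rw [← hp] at h1
      rw [sum_prod_mul_cylinderGranted a hkK (hp0 k).ne'] at h1
      simp_rw [mul_assoc (∏ u : S, neighbourhoodMass D N (assignedSet a u))]
      rw [← Finset.mul_sum]
      refine mul_le_mul (Finset.prod_le_prod (fun u _ => mul_nonneg ENNReal.toReal_nonneg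
        (by positivity)) fun u _ => ?_) h1 (by have := hΨ (fibreCard a); positivity)
        (Finset.prod_nonneg fun u _ => neighbourhoodMass_nonneg _ _ _)
      rw [← card_assignedSet]
      exact le_neighbourhoodMass D _
    · exact Finset.sum_nonneg fun c _ => mul_nonneg (mul_nonneg (Finset.prod_nonneg fun u _ =>
        neighbourhoodMass_nonneg _ _ _) (Finset.prod_nonneg fun u _ => traceMass_nonneg _ _ _))
        (cylinderGranted_nonneg _ _ _)

/-- The bound for fixed `S` depends only on its size; the number of such `S` is at least `θ * N ^ (k
+ 1) / (k + 1)!`, whence the fourth `θ`. -/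
theorem LocalApprox.le_expect_grantedProb (h : LocalApprox D N n L m μ θ) (v : Fin N)
    (hμ : 0 < μ) (hθ : 0 ≤ θ) (hnK : n ≤ K) (hKN : K ≤ N) (hL : n * (K + 1) ^ 2 ≤ L)
    {p : ℕ → ℝ} (hp : ∀ r, p r = Real.exp (-m) * μ ^ r / r.factorial) :
    ∑ k ∈ Finset.range n, θ ^ 4 * (Real.exp (-m) / (k + 1).factorial *
      ((∑ e ∈ Finset.range K, sizeBiasedMass D e * (∑ j ∈ Finset.range K, p j) ^ e) ^ (k + 1) -
        (∑ e ∈ Finset.range K, sizeBiasedMass D e * ((∑ j ∈ Finset.range K, p j) ^ e -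
          tieMean (p k) (∑ j ∈ Finset.Ico (k + 1) K, p j) e)) ^ (k + 1))) ≤
    expect (outGraphLaw D N) fun G => grantedProb G v := by
  have hN : 0 < N := v.pos
  have hN' : (0 : ℝ) < N := by exact_mod_cast hN
  have hp0 : ∀ r, 0 < p r := fun r => by rw [hp]; positivity
  refine le_trans (Finset.sum_le_sum fun k hk => ?_) (sum_cylinder_le_expect_grantedProb D v n)
  rw [Finset.mem_range] at hk
  have hkK : k < K := hk.trans_le hnK
  refine le_trans ?_ (Finset.card_nsmul_le_sum _ _ _ fun S hS =>
    h.le_sum_assignment hN hμ hθ (Finset.mem_powersetCard.1 hS).2 hk hkK hKN hL hp)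
  have hTn := tieMean_nonneg_and_le_pow (fun j => (hp0 j).le) hkK (hp0 k).ne'
  set X : ℝ := _ - _ with hX
  have hX0 : 0 ≤ X := by
    refine sub_nonneg.2 (pow_le_pow_left₀ (Finset.sum_nonneg fun e _ => mul_nonneg
      (sizeBiasedMass_nonneg D e) (sub_nonneg.2 (hTn e).2)) (Finset.sum_le_sum fun e _ =>
        mul_le_mul_of_nonneg_left (sub_le_self _ (hTn e).1) (sizeBiasedMass_nonneg D e)) _)
  rw [Finset.card_powersetCard, Finset.card_univ, Fintype.card_fin, nsmul_eq_mul]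
  have hd : θ * (N : ℝ) ^ (k + 1) ≤ (N.choose (k + 1) : ℝ) * (k + 1).factorial := by
    have hkL : k + 1 ≤ L := le_trans (by nlinarith [Nat.zero_le (n * K)]) hL
    refine (h.desc _ hkL).trans ?_
    rw [mul_comm]
    exact_mod_cast (Nat.descFactorial_le _ (Nat.sub_le N n)).trans
      (Nat.descFactorial_eq_factorial_mul_choose N (k + 1)).le
  have hf : (0 : ℝ) < (k + 1).factorial := by positivity
  calc _ = θ * (N : ℝ) ^ (k + 1) / (k + 1).factorial *
        (θ ^ 3 * Real.exp (-m) / (N : ℝ) ^ (k + 1) * X) := by field_simp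
    _ ≤ _ := by
        refine mul_le_mul_of_nonneg_right ?_ (by positivity)
        rwa [div_le_iff₀ hf]

end

/-! ### The limit in `N` -/

open Filter Topology

theorem eventually_mul_pow_le_descFactorial (n L : ℕ) {θ : ℝ} (hθ : θ < 1) :
    ∀ᶠ N : ℕ in atTop, ∀ R ≤ L, θ * (N : ℝ) ^ R ≤ (N - n).descFactorial R := by
  have h : ∀ R ∈ Finset.range (L + 1), ∀ᶠ N : ℕ in atTop,
      θ * (N : ℝ) ^ R ≤ (N - n).descFactorial R := by
    intro R _
    have hlim : Tendsto (fun N : ℕ => (1 - ((n + R : ℕ) : ℝ) / N) ^ R) atTop (𝓝 1) := by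
      simpa using ((tendsto_const_div_atTop_nhds_zero_nat ((n + R : ℕ) : ℝ)).const_sub 1).pow R
    filter_upwards [hlim.eventually (eventually_ge_nhds hθ), eventually_gt_atTop (n + R)]
      with N h1 h2
    have hN : (0 : ℝ) < N := by exact_mod_cast (by omega : 0 < N)
    calc θ * (N : ℝ) ^ R ≤ (1 - ((n + R : ℕ) : ℝ) / N) ^ R * (N : ℝ) ^ R := by gcongr
      _ = ((N - (n + R) : ℕ) : ℝ) ^ R := by
          rw [← mul_pow, sub_mul, one_mul, div_mul_cancel₀ _ hN.ne', Nat.cast_sub h2.le]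
      _ ≤ ((N - n + 1 - R : ℕ) : ℝ) ^ R :=
          pow_le_pow_left₀ (Nat.cast_nonneg _) (Nat.cast_le.2 (by omega)) R
      _ ≤ _ := by exact_mod_cast Nat.pow_sub_le_descFactorial (N - n) R
  filter_upwards [(eventually_all_finset _).2 h] with N hN R hR
  exact hN R (Finset.mem_range.2 (by omega))

theorem hasSum_sizeBiasedMass {D : PMF ℕ} (hD : Summable fun k : ℕ => (D k).toReal * (k : ℝ)) :
    HasSum (sizeBiasedMass D) (mean D) := by
  have h := (hasSum_nat_add_iff' 1).2 hD.hasSum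
  simp only [Finset.range_one, Finset.sum_singleton, Nat.cast_zero, mul_zero, sub_zero,
    Nat.cast_succ] at h
  exact h

/-- The field `empty` is the limit of `(1 - j m / N) ^ N`, with `j` the size of `W`. For `single`,
the strict inequality `μ < mean D` leaves room to cut the degrees off at some `K` and to absorb the
error in the binomial coefficients. -/
theorem eventually_localApprox {D : PMF ℕ} (hD : Summable fun k : ℕ => (D k).toReal * (k : ℝ))
    (n L : ℕ) {μ θ : ℝ} (hμ0 : 0 ≤ μ) (hμ : μ < mean D) (hθ : θ < 1) :
    ∀ᶠ N : ℕ in atTop, LocalApprox D N n L (mean D) μ θ := by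
  have hm : 0 < mean D := hμ0.trans_lt hμ
  have hempty : ∀ j ∈ Finset.range (L + 1), ∀ᶠ N : ℕ in atTop,
      0 ≤ 1 + -(j * mean D) / (N : ℝ) ∧
        θ * Real.exp (-mean D) ^ j ≤ (1 + -(j * mean D) / (N : ℝ)) ^ N := by
    intro j _
    have h1 : Tendsto (fun N : ℕ => 1 + -(j * mean D) / (N : ℝ)) atTop (𝓝 1) := by
      simpa using (tendsto_const_div_atTop_nhds_zero_nat (-(j * mean D))).const_add 1
    have h2 := Real.tendsto_one_add_div_pow_exp (-(j * mean D))
    have h3 : θ * Real.exp (-mean D) ^ j < Real.exp (-(j * mean D)) := by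
      rw [← Real.exp_nat_mul, mul_neg]
      exact mul_lt_of_lt_one_left (Real.exp_pos _) hθ
    exact (h1.eventually (eventually_ge_nhds zero_lt_one)).and
      (h2.eventually (eventually_ge_nhds h3))
  obtain ⟨K, hK⟩ := ((hasSum_sizeBiasedMass hD).tendsto_sum_nat.eventually
    (eventually_gt_nhds hμ)).exists
  set M := ∑ d ∈ Finset.range K, sizeBiasedMass D d with hM
  have hM0 : 0 < M := hμ0.trans_lt hK
  -- This ratio is the loss allowed in each binomial coefficient in `single`.
  have hθ' : μ / M < 1 := (div_lt_one hM0).2 hK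
  filter_upwards [eventually_mul_pow_le_descFactorial n L hθ, (eventually_all_finset _).2 hempty,
    eventually_mul_pow_le_descFactorial L K hθ', eventually_ge_atTop K, eventually_gt_atTop 0]
    with N h1 h2 h3 h4 h5
  have hN : (0 : ℝ) < N := by exact_mod_cast h5
  refine ⟨h1, fun W hW => ?_, fun W hW w hw => ?_⟩
  · obtain ⟨h6, h7⟩ := h2 W.card (Finset.mem_range.2 (by omega))
    refine h7.trans (pow_le_pow_left₀ h6 (le_trans (le_of_eq ?_) (le_traceMass_empty hD W)) N)
    ring
  · refine le_trans ?_ (le_traceMass_singleton D hw K)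
    calc μ / N = ∑ d ∈ Finset.range K, sizeBiasedMass D d * (μ / M / N) := by
          rw [← Finset.sum_mul, ← hM]; field_simp
      _ ≤ _ := Finset.sum_le_sum fun d hd => ?_
    rw [Finset.mem_range] at hd
    rw [sizeBiasedMass, mul_assoc]
    refine mul_le_mul_of_nonneg_left ?_ ENNReal.toReal_nonneg
    have h6 : μ / M * (N : ℝ) ^ d ≤ (d.factorial : ℝ) * (N - W.card).choose d := by
      refine (h3 d hd.le).trans ?_
      exact_mod_cast (Nat.descFactorial_le _ (Nat.sub_le_sub_left hW N)).trans
        (Nat.descFactorial_eq_factorial_mul_choose _ d).le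
    have hf : (0 : ℝ) < d.factorial := by positivity
    calc ((d : ℝ) + 1) * (μ / M / N) = (μ / M * (N : ℝ) ^ d / d.factorial) *
          ((d + 1).factorial / (N : ℝ) ^ (d + 1)) := by
          rw [Nat.factorial_succ]; push_cast; field_simp; ring
      _ ≤ _ := by
          refine mul_le_mul ?_ (inv_choose_ge (by omega)) (by positivity) (by positivity)
          rwa [div_le_iff₀ hf, mul_comm ((N - W.card).choose d : ℝ)]

/-- Dominated convergence in which `K` governs both the terms and the range of summation. -/
theorem tendsto_sum_range_of_dominated {f : ℕ → ℕ → ℝ} {g bound : ℕ → ℝ} (hb : Summable bound)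
    (hlim : ∀ e, Tendsto (fun K => f K e) atTop (𝓝 (g e)))
    (hf : ∀ᶠ K in atTop, ∀ e, |f K e| ≤ bound e) :
    Tendsto (fun K => ∑ e ∈ Finset.range K, f K e) atTop (𝓝 (∑' e, g e)) := by
  have h : ∀ K, ∑ e ∈ Finset.range K, f K e = ∑' e, if e < K then f K e else 0 := by
    intro K
    rw [tsum_eq_sum (s := Finset.range K) fun e he => if_neg (by simpa using he)]
    exact Finset.sum_congr rfl fun e he => (if_pos (Finset.mem_range.1 he)).symm
  simp_rw [h]
  refine tendsto_tsum_of_dominated_convergence hb (fun e => ?_) ?_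
  · refine (hlim e).congr' ?_
    filter_upwards [eventually_gt_atTop e] with K hK
    rw [if_pos hK]
  · filter_upwards [hf] with K hK e
    split_ifs
    · exact hK e
    · simpa using (abs_nonneg _).trans (hK e)

/-! ### The limit in the truncation `K` -/

theorem poissonMass_pos {m : ℝ} (hm : 0 < m) (k : ℕ) : 0 < poissonMass m k := by
  unfold poissonMass; positivity

theorem hasSum_poissonMass (m : ℝ) : HasSum (poissonMass m) 1 := by
  have h := (NormedSpace.expSeries_div_hasSum_exp (𝔸 := ℝ) m).mul_left (Real.exp (-m))
  rw [← Real.exp_eq_exp_ℝ, ← Real.exp_add, neg_add_cancel, Real.exp_zero] at h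
  simp only [← mul_div_assoc] at h
  exact h

theorem poissonTail_natCast_sub_one (m : ℝ) (k : ℕ) :
    poissonTail m ((k : ℤ) - 1) = 1 - ∑ j ∈ Finset.range k, poissonMass m j := by
  simp [poissonTail, poissonCdf]

/-- The truncated masses that approximate those of the Poisson law. -/
noncomputable def approxMass (m : ℝ) (K r : ℕ) : ℝ :=
  Real.exp (-m) * (m * (K / (K + 1))) ^ r / r.factorial

theorem tendsto_natCast_div_add_one : Tendsto (fun K : ℕ => (K : ℝ) / (K + 1)) atTop (𝓝 1) :=
  tendsto_natCast_div_add_atTop 1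

section

variable {m : ℝ}

theorem approxMass_nonneg (hm : 0 ≤ m) (K r : ℕ) : 0 ≤ approxMass m K r := by
  unfold approxMass; positivity

theorem approxMass_pos (hm : 0 < m) {K : ℕ} (hK : 0 < K) (r : ℕ) : 0 < approxMass m K r := by
  unfold approxMass; positivity

/-- Only the base of the power is shrunk, while the factor `exp (-m)` is kept; so the Poisson masses
dominate for every `K`. -/
theorem approxMass_le (hm : 0 ≤ m) (K r : ℕ) : approxMass m K r ≤ poissonMass m r := by
  unfold approxMass poissonMass
  have h : m * ((K : ℝ) / (K + 1)) ≤ m :=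
    mul_le_of_le_one_right hm ((div_le_one (by positivity)).2 (by linarith))
  gcongr

theorem tendsto_approxMass (m : ℝ) (r : ℕ) :
    Tendsto (fun K => approxMass m K r) atTop (𝓝 (poissonMass m r)) := by
  unfold approxMass poissonMass
  have h := ((tendsto_natCast_div_add_one.const_mul m).pow r).const_mul (Real.exp (-m))
  rw [mul_one] at h
  exact h.div_const _

theorem sum_approxMass_le_one (hm : 0 ≤ m) (K n : ℕ) :
    ∑ j ∈ Finset.range n, approxMass m K j ≤ 1 :=
  (Finset.sum_le_sum fun j _ => approxMass_le hm K j).trans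
    (sum_le_hasSum _ (fun j _ => by unfold poissonMass; positivity) (hasSum_poissonMass m))

theorem tendsto_sum_approxMass (hm : 0 ≤ m) :
    Tendsto (fun K => ∑ j ∈ Finset.range K, approxMass m K j) atTop (𝓝 1) := by
  rw [← (hasSum_poissonMass m).tsum_eq]
  refine tendsto_sum_range_of_dominated (hasSum_poissonMass m).summable (tendsto_approxMass m)
    (Eventually.of_forall fun K e => ?_)
  rw [abs_of_nonneg (approxMass_nonneg hm K e)]
  exact approxMass_le hm K e

theorem tendsto_sum_Ico_approxMass (hm : 0 ≤ m) (k : ℕ) :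
    Tendsto (fun K => ∑ j ∈ Finset.Ico k K, approxMass m K j) atTop
      (𝓝 (poissonTail m ((k : ℤ) - 1))) := by
  rw [poissonTail_natCast_sub_one]
  refine ((tendsto_sum_approxMass hm).sub (tendsto_finsetSum (Finset.range k) fun j _ =>
    tendsto_approxMass m j)).congr' ?_
  filter_upwards [eventually_ge_atTop k] with K hK
  rw [Finset.sum_Ico_eq_sub _ hK]

/-- The limiting probability that a neighbour with `e` other neighbours selects a given receiver
of degree `k + 1`. -/
noncomputable def limitTieMean (m : ℝ) (k e : ℕ) : ℝ :=
  tieMean (poissonMass m k) (poissonTail m k) e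

theorem tendsto_tieMean (hm : 0 < m) (k e : ℕ) :
    Tendsto (fun K => tieMean (approxMass m K k)
      (∑ j ∈ Finset.Ico (k + 1) K, approxMass m K j) e) atTop (𝓝 (limitTieMean m k e)) := by
  have h1 := tendsto_approxMass m k
  have h2 := tendsto_sum_Ico_approxMass hm.le (k + 1)
  rw [Nat.cast_succ, add_sub_cancel_right] at h2
  unfold limitTieMean tieMean
  have := (poissonMass_pos hm k).ne'
  exact (((h1.add h2).pow _).sub (h2.pow _)).div (h1.const_mul _) (by positivity)

theorem tieMean_mem_Icc (hm : 0 < m) {k K : ℕ} (hk : k < K) (e : ℕ) :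
    tieMean (approxMass m K k) (∑ j ∈ Finset.Ico (k + 1) K, approxMass m K j) e ∈
      Set.Icc (0 : ℝ) 1 := by
  have h := tieMean_nonneg_and_le_pow (approxMass_nonneg hm.le K) hk
    (approxMass_pos hm (by omega) k).ne' e
  exact ⟨h.1, h.2.trans (pow_le_one₀ (Finset.sum_nonneg fun j _ => approxMass_nonneg hm.le K j)
    (sum_approxMass_le_one hm.le K K))⟩

theorem limitTieMean_mem_Icc (hm : 0 < m) (k e : ℕ) :
    limitTieMean m k e ∈ Set.Icc (0 : ℝ) 1 :=
  isClosed_Icc.mem_of_tendsto (tendsto_tieMean hm k e)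
    ((eventually_gt_atTop k).mono fun _ hK => tieMean_mem_Icc hm hK e)

theorem poissonTail_mem_Icc (hm : 0 ≤ m) (k : ℤ) :
    poissonTail m k ∈ Set.Icc (0 : ℝ) 1 := by
  have h0 : ∀ j, 0 ≤ poissonMass m j := fun j => by unfold poissonMass; positivity
  exact ⟨sub_nonneg.2 (sum_le_hasSum _ (fun j _ => h0 j) (hasSum_poissonMass m)),
    sub_le_self _ (Finset.sum_nonneg fun j _ => h0 j)⟩

end

section

variable {D : PMF ℕ}

theorem summable_genFun {z : ℝ} (hz : z ∈ Set.Icc (0 : ℝ) 1) :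
    Summable fun k => (D k).toReal * z ^ k :=
  summable_toReal_mul (fun k => pow_nonneg hz.1 k) fun _ => pow_le_one₀ hz.1 hz.2

/-- The factor `e + 1` of the size bias cancels the denominator of `tieMean`. What remains is a
difference of two generating functions, whose constant terms cancel. -/
theorem hasSum_sizeBiasedMass_mul_limitTieMean (hm : 0 < mean D) (k : ℕ) :
    HasSum (fun e => sizeBiasedMass D e * limitTieMean (mean D) k e)
      (mean D * selectionProb D (k + 1)) := by
  have hq := poissonMass_pos hm k
  have ha := poissonTail_mem_Icc hm.le ((k : ℤ) - 1)
  have hb := poissonTail_mem_Icc hm.le (k : ℤ)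
  have hab : poissonMass (mean D) k + poissonTail (mean D) k =
      poissonTail (mean D) ((k : ℤ) - 1) := by
    have h := poissonTail_natCast_sub_one (mean D) (k + 1)
    rw [Nat.cast_succ, add_sub_cancel_right, Finset.sum_range_succ] at h
    rw [h, poissonTail_natCast_sub_one]
    ring
  have h := ((summable_genFun (D := D) ha).hasSum.sub (summable_genFun (D := D) hb).hasSum)
  have h' := ((hasSum_nat_add_iff' 1).2 h).div_const (poissonMass (mean D) k)
  simp only [Finset.range_one, Finset.sum_singleton, pow_zero, sub_self, sub_zero] at h'
  have e1 : (fun e => sizeBiasedMass D e * limitTieMean (mean D) k e) = fun e =>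
      ((D (e + 1)).toReal * poissonTail (mean D) ((k : ℤ) - 1) ^ (e + 1) -
        (D (e + 1)).toReal * poissonTail (mean D) k ^ (e + 1)) / poissonMass (mean D) k := by
    funext e
    rw [limitTieMean, tieMean, hab, sizeBiasedMass]
    have : (e : ℝ) + 1 ≠ 0 := by positivity
    field_simp
  have e2 : mean D * selectionProb D (k + 1) = (genFun D (poissonTail (mean D) ((k : ℤ) - 1)) -
      genFun D (poissonTail (mean D) k)) / poissonMass (mean D) k := by
    have h1 : ((k + 1 : ℕ) : ℤ) - 2 = (k : ℤ) - 1 := by push_cast; ring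
    have h2 : ((k + 1 : ℕ) : ℤ) - 1 = k := by push_cast; ring
    unfold selectionProb
    rw [if_neg (Nat.succ_ne_zero k), h1, h2, Nat.add_sub_cancel]
    field_simp
  rw [e1, e2]
  exact h'

/-- For `s ≥ 1`, `selectionProb D s` is an average of the numbers `limitTieMean`, which lie in `[0,
1]`, under weights of total mass `mean D`. -/
theorem selectionProb_mem_Icc (hD : Summable fun k : ℕ => (D k).toReal * (k : ℝ))
    (hm : 0 < mean D) (s : ℕ) : selectionProb D s ∈ Set.Icc (0 : ℝ) 1 := by
  rcases s with _ | k
  · simp [selectionProb]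
  have h := hasSum_sizeBiasedMass_mul_limitTieMean hm k
  have h0 := h.nonneg fun e => mul_nonneg (sizeBiasedMass_nonneg D e)
    (limitTieMean_mem_Icc hm k e).1
  have h1 := hasSum_le (fun e => mul_le_of_le_one_right (sizeBiasedMass_nonneg D e)
    (limitTieMean_mem_Icc hm k e).2) h (hasSum_sizeBiasedMass hD)
  exact ⟨nonneg_of_mul_nonneg_right h0 hm, le_of_mul_le_mul_left (by simpa using h1) hm⟩

/-- The lower bound for the probability of a grant to a receiver of degree `k + 1`. -/
noncomputable def truncatedBound (D : PMF ℕ) (K k : ℕ) : ℝ :=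
  Real.exp (-mean D) / (k + 1).factorial *
    ((∑ e ∈ Finset.range K, sizeBiasedMass D e *
        (∑ j ∈ Finset.range K, approxMass (mean D) K j) ^ e) ^ (k + 1) -
      (∑ e ∈ Finset.range K, sizeBiasedMass D e *
        ((∑ j ∈ Finset.range K, approxMass (mean D) K j) ^ e -
          tieMean (approxMass (mean D) K k)
            (∑ j ∈ Finset.Ico (k + 1) K, approxMass (mean D) K j) e)) ^ (k + 1))

theorem tendsto_truncatedBound (hD : Summable fun k : ℕ => (D k).toReal * (k : ℝ))
    (hm : 0 < mean D) (k : ℕ) :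
    Tendsto (fun K => truncatedBound D K k) atTop (𝓝 (poissonMass (mean D) (k + 1) *
      (1 - (1 - selectionProb D (k + 1)) ^ (k + 1)))) := by
  have hs := (hasSum_sizeBiasedMass hD).summable
  have hτ := tendsto_sum_approxMass hm.le
  have h1 : Tendsto (fun K => ∑ e ∈ Finset.range K, sizeBiasedMass D e *
      (∑ j ∈ Finset.range K, approxMass (mean D) K j) ^ e) atTop
      (𝓝 (∑' e, sizeBiasedMass D e)) := by
    refine tendsto_sum_range_of_dominated hs (fun e => ?_) (Eventually.of_forall fun K e => ?_)
    · simpa using (hτ.pow e).const_mul (sizeBiasedMass D e)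
    · have h0 : 0 ≤ ∑ j ∈ Finset.range K, approxMass (mean D) K j :=
        Finset.sum_nonneg fun j _ => approxMass_nonneg hm.le K j
      have hw := sizeBiasedMass_nonneg D e
      rw [abs_of_nonneg (by positivity)]
      exact mul_le_of_le_one_right hw (pow_le_one₀ h0 (sum_approxMass_le_one hm.le K K))
  have h2 : Tendsto (fun K => ∑ e ∈ Finset.range K, sizeBiasedMass D e *
      tieMean (approxMass (mean D) K k)
        (∑ j ∈ Finset.Ico (k + 1) K, approxMass (mean D) K j) e) atTop
      (𝓝 (mean D * selectionProb D (k + 1))) := by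
    rw [← (hasSum_sizeBiasedMass_mul_limitTieMean hm k).tsum_eq]
    refine tendsto_sum_range_of_dominated hs (fun e => (tendsto_tieMean hm k e).const_mul _) ?_
    filter_upwards [eventually_gt_atTop k] with K hK e
    have hw := sizeBiasedMass_nonneg D e
    have ht := tieMean_mem_Icc hm hK e
    rw [abs_of_nonneg (mul_nonneg hw ht.1)]
    exact mul_le_of_le_one_right hw ht.2
  rw [(hasSum_sizeBiasedMass hD).tsum_eq] at h1
  unfold truncatedBound
  simp_rw [mul_sub, Finset.sum_sub_distrib]
  have h3 := ((h1.pow (k + 1)).sub ((h1.sub h2).pow (k + 1))).const_mul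
    (Real.exp (-mean D) / (k + 1).factorial)
  simp_rw [mul_sub] at h3
  convert h3 using 2
  rw [poissonMass, ← mul_one_sub, mul_pow]
  ring

/-- One parameter governs all errors: both `θ` and `μ / mean D` equal `K / (K + 1)`. The bound is
the same for all `N` receivers, so averaging keeps it. -/
theorem eventually_truncatedBound_le (hD : Summable fun k : ℕ => (D k).toReal * (k : ℝ))
    (hm : 0 < mean D) {n K : ℕ} (hnK : n ≤ K) (hK : 0 < K) :
    ∀ᶠ N : ℕ in atTop, ((K : ℝ) / (K + 1)) ^ 4 * ∑ k ∈ Finset.range n, truncatedBound D K k ≤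
      1 / (N : ℝ) * meanMatchingSize D N := by
  have hK1 : (K : ℝ) / (K + 1) < 1 := (div_lt_one (by positivity)).2 (by linarith)
  have hK0 : (0 : ℝ) < (K : ℝ) / (K + 1) := by positivity
  have hμ : mean D * ((K : ℝ) / (K + 1)) < mean D := mul_lt_of_lt_one_right hm hK1
  filter_upwards [eventually_localApprox hD n (n * (K + 1) ^ 2) (by positivity) hμ hK1,
    eventually_ge_atTop K] with N h hN
  have hN' : (0 : ℝ) < N := by exact_mod_cast (by omega : 0 < N)
  rw [meanMatchingSize_eq, one_div, inv_mul_eq_div, le_div_iff₀ hN', mul_comm, ← nsmul_eq_mul]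
  refine le_trans (le_of_eq ?_) (Finset.card_nsmul_le_sum Finset.univ _ _ fun v _ =>
    h.le_expect_grantedProb v (by positivity) hK0.le hnK hN le_rfl
      (p := approxMass (mean D) K) fun _ => rfl)
  rw [Finset.card_univ, Fintype.card_fin, Finset.mul_sum]
  rfl

theorem poissonMass_mul_nonneg (hD : Summable fun k : ℕ => (D k).toReal * (k : ℝ))
    (hm : 0 < mean D) (s : ℕ) :
    0 ≤ poissonMass (mean D) s * (1 - selectionProb D s) ^ s ∧
      poissonMass (mean D) s * (1 - selectionProb D s) ^ s ≤ poissonMass (mean D) s := by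
  have h := selectionProb_mem_Icc hD hm s
  have h0 := poissonMass_pos hm s
  have h1 : 0 ≤ 1 - selectionProb D s := sub_nonneg.2 h.2
  exact ⟨by positivity, mul_le_of_le_one_right h0.le (pow_le_one₀ h1 (sub_le_self _ h.1))⟩

theorem summable_poissonMass_mul (hD : Summable fun k : ℕ => (D k).toReal * (k : ℝ))
    (hm : 0 < mean D) :
    Summable fun s => poissonMass (mean D) s * (1 - selectionProb D s) ^ s :=
  (hasSum_poissonMass _).summable.of_nonneg_of_le (fun s => (poissonMass_mul_nonneg hD hm s).1)
    fun s => (poissonMass_mul_nonneg hD hm s).2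

theorem le_liminf_meanMatchingSize (hD : Summable fun k : ℕ => (D k).toReal * (k : ℝ))
    (hm : 0 < mean D) :
    1 - ∑' s, poissonMass (mean D) s * (1 - selectionProb D s) ^ s ≤
      liminf (fun N : ℕ => 1 / (N : ℝ) * meanMatchingSize D N) atTop := by
  have hsum := (hasSum_poissonMass (mean D)).sub (summable_poissonMass_mul hD hm).hasSum
  -- The term `s = 0` vanishes because the power with exponent `0` is `1`; the sum then runs over
  -- the degrees `k + 1` of the cylinders.
  have hshift := ((hasSum_nat_add_iff' 1).2 hsum).tendsto_sum_nat
  simp only [Finset.range_one, Finset.sum_singleton, pow_zero, mul_one, sub_self,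
    sub_zero] at hshift
  -- Without an upper bound the real `liminf` could be a default value; a matching has at most `N`
  -- edges.
  have hcob : IsCoboundedUnder (· ≥ ·) atTop fun N : ℕ => 1 / (N : ℝ) * meanMatchingSize D N := by
    refine (isBoundedUnder_of ⟨1, fun N => ?_⟩).isCoboundedUnder_ge
    rw [one_div, inv_mul_eq_div]
    exact div_le_one_of_le₀ (meanMatchingSize_le D N) (Nat.cast_nonneg N)
  -- For any `x` below the bound, first `n` and then `K` are fixed so that the truncated bound still
  -- exceeds `x`.
  refine le_of_forall_lt_imp_le_of_dense fun x hx => ?_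
  obtain ⟨n, hn⟩ := (hshift.eventually (eventually_gt_nhds hx)).exists
  have hlim : Tendsto (fun K : ℕ => ((K : ℝ) / (K + 1)) ^ 4 *
      ∑ k ∈ Finset.range n, truncatedBound D K k) atTop
      (𝓝 (∑ k ∈ Finset.range n, (poissonMass (mean D) (k + 1) -
        poissonMass (mean D) (k + 1) * (1 - selectionProb D (k + 1)) ^ (k + 1)))) := by
    simpa [mul_sub] using (tendsto_natCast_div_add_one.pow 4).mul
      (tendsto_finsetSum (Finset.range n) fun k _ => tendsto_truncatedBound hD hm k)
  obtain ⟨K, hK, hnK, hK0⟩ := ((hlim.eventually (eventually_gt_nhds hn)).and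
    ((eventually_ge_atTop n).and (eventually_gt_atTop 0))).exists
  exact le_liminf_of_le hcob
    ((eventually_truncatedBound_le hD hm hnK hK0).mono fun N hN => hK.le.trans hN)

end

end DegreeBiased

theorem mainTheorem2 (D : PMF ℕ)
    (hD : Summable fun k : ℕ => (D k).toReal * (k : ℝ))
    (hpos : 0 < DegreeBiased.mean D) :
    (∀ s : ℕ, DegreeBiased.selectionProb D s ∈ Set.Icc (0 : ℝ) 1) ∧
    (Summable fun s : ℕ => Real.exp (-DegreeBiased.mean D) * DegreeBiased.mean D ^ s /
      (s.factorial : ℝ) * (1 - DegreeBiased.selectionProb D s) ^ s) ∧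
    1 - ∑' s : ℕ, Real.exp (-DegreeBiased.mean D) * DegreeBiased.mean D ^ s /
        (s.factorial : ℝ) * (1 - DegreeBiased.selectionProb D s) ^ s ≤
      Filter.liminf (fun N : ℕ => 1 / (N : ℝ) * DegreeBiased.meanMatchingSize D N)
        Filter.atTop :=
  ⟨DegreeBiased.selectionProb_mem_Icc hD hpos, DegreeBiased.summable_poissonMass_mul hD hpos,
    DegreeBiased.le_liminf_meanMatchingSize hD hpos⟩
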